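/- Let $n\ge 1$, $\mu>0$, $\beta>1$, $R\ge 1$, and set $\gamma(p,n)=2+(n+1)p-(n-1)p^2$. Let $1<p<p_S(n)$ if $n\ge 2$, where $p_S(n)=\frac{n+1+\sqrt{n^2+10n-7}}{2(n-1)}$ is the positive root of $\gamma(\cdot,n)$, and let $1<p<\infty$ be arbitrary if $n=1$. Let $f\in H^1(\mathbf R^n)$ and $g\in L^2(\mathbf R^n)$ be nonnegative, with $f$ not vanishing identically. For $\varepsilon>0$ and $T\in(0,\infty]$, an energy solution over $[0,T)$ of $$u_{tt}-\Delta u+\frac{\mu}{(1+t)^\beta}u_t=|u|^p,\qquad u(x,0)=\varepsilon f(x),\quad u_t(x,0)=\varepsilon g(x)\qquad(*)$$ is a function $u\in C([0,T),H^1(\mathbf R^n))\cap C^1([0,T),L^2(\mathbf R^n))\cap L^p_{\rm loc}(\mathbf R^n\times(0,T))$ that has these initial values and satisfies, with all integrals convergent, $$\int_{\mathbf R^n}u_t(x,t)\phi(x,t)\,dx-\int_{\mathbf R^n}u_t(x,0)\phi(x,0)\,dx+\int_0^t\!ds\int_{\mathbf R^n}\{-u_t\phi_t+\nabla u\cdot\nabla\phi\}(x,s)\,dx$$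 $$+\int_0^t\!ds\int_{\mathbf R^n}\frac{\mu u_t(x,s)}{(1+s)^\beta}\phi(x,s)\,dx=\int_0^t\!ds\int_{\mathbf R^n}|u(x,s)|^p\phi(x,s)\,dx$$ for all $\phi\in C_0^\infty(\mathbf R^n\times[0,T))$ and all $t\in[0,T)$. Then there are constants $\varepsilon_0>0$ and $C>0$, depending only on $f,g,n,p,\mu,\beta,R$, such that the following holds for every $0<\varepsilon\le\varepsilon_0$: if $u$ is an energy solution of $(*)$ over $[0,T)$, $0<T\le\infty$, with $$\operatorname{supp}u\subset\{(x,t)\in\mathbf R^n\times[0,T):|x|\le t+R\},$$ then $$T\le C\varepsilon^{-2p(p-1)/\gamma(p,n)}.$$ In particular $T<\infty$: no such solution exists globally in time. -/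

import Mathlib

open MeasureTheory Set
open scoped ContDiff

noncomputable section

namespace DampedWave

/-- The space `ℝⁿ` with the Euclidean norm. -/
abbrev E (n : ℕ) : Type := EuclideanSpace ℝ (Fin n)

/-- `γ(p, n) = 2 + (n + 1) p - (n - 1) p²`. -/
def straussGamma (p : ℝ) (n : ℕ) : ℝ :=
  2 + ((n : ℝ) + 1) * p - ((n : ℝ) - 1) * p ^ 2

/-- The Strauss exponent `p_S(n)`, the positive root of `γ(p, n) = 0`; meaningful for `n ≥ 2`. -/
def straussExponent (n : ℕ) : ℝ :=
  ((n : ℝ) + 1 + √((n : ℝ) ^ 2 + 10 * (n : ℝ) - 7)) / (2 * ((n : ℝ) - 1))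

/-- The vector field `G` is the weak gradient of `v` on `ℝⁿ`. It is used only for `v` and `G`
that are square integrable, so that both integrals converge. -/
def HasWeakGradient {n : ℕ} (v : E n → ℝ) (G : E n → E n) : Prop :=
  ∀ η : E n → ℝ, ContDiff ℝ ∞ η → HasCompactSupport η →
    ∫ x, v x • gradient η x = - ∫ x, η x • G x

/-- `v ∈ H¹(ℝⁿ)`. -/
def MemH1 {n : ℕ} (v : E n → ℝ) : Prop :=
  MemLp v 2 ∧ ∃ G : E n → E n, MemLp G 2 ∧ HasWeakGradient v G

/-- The time interval `[0, T)`, where `T` may be `⊤`. -/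
def timeInterval (T : EReal) : Set ℝ := {t | 0 ≤ t ∧ (t : EReal) < T}

/-- A test function of class `C₀^∞(ℝⁿ × [0, T))`, time being the first coordinate. Such a function
is the restriction to `t ≥ 0` of a smooth function on the whole space-time whose support is compact
and contained in `{t < T}`; only its values for `t ≥ 0` are ever used. -/
structure IsTestFunction {n : ℕ} (T : EReal) (φ : ℝ × E n → ℝ) : Prop where
  smooth : ContDiff ℝ ∞ φ
  compact : HasCompactSupport φ
  support : ∀ z ∈ tsupport φ, (z.1 : EReal) < T

/-- The function `u`, with weak spatial gradient `G` and time derivative `V` (curves in `L²`), is an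
energy solution over `[0, T)` of
`u_tt - Δu + μ (1 + t)^(-β) u_t = |u|^p`, `u(·, 0) = ε f`, `u_t(·, 0) = ε g` on `ℝⁿ`.
Here `U` is `u` itself, regarded as a curve in `L²`. -/
structure IsEnergySolutionWith {n : ℕ} (p μ β ε : ℝ) (f g : E n → ℝ) (T : EReal)
    (u : ℝ → E n → ℝ) (U : ℝ → Lp ℝ 2 (volume : Measure (E n)))
    (G : ℝ → Lp (E n) 2 (volume : Measure (E n)))
    (V : ℝ → Lp ℝ 2 (volume : Measure (E n))) : Prop where
  /-- `u` is measurable on space-time -/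
  aestronglyMeasurable : AEStronglyMeasurable (fun z : ℝ × E n => u z.1 z.2)
    (volume.restrict (timeInterval T ×ˢ univ))
  /-- `U t` is the class of `u(·, t)` -/
  ae_eq : ∀ t ∈ timeInterval T, u t =ᵐ[volume] U t
  /-- `G t` is the weak gradient of `u(·, t)` -/
  weakGradient : ∀ t ∈ timeInterval T, HasWeakGradient (U t) (G t)
  /-- `u ∈ C([0, T), H¹)`: the curve and its gradient are continuous in `L²` -/
  continuousOn_U : ContinuousOn U (timeInterval T)
  continuousOn_G : ContinuousOn G (timeInterval T)
  /-- `u ∈ C¹([0, T), L²)` with `u_t = V` -/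
  hasDeriv : ∀ t ∈ timeInterval T, HasDerivWithinAt U (V t) (timeInterval T) t
  continuousOn_V : ContinuousOn V (timeInterval T)
  /-- `u ∈ L^p_loc(ℝⁿ × (0, T))` -/
  locallyIntegrableOn : LocallyIntegrableOn (fun z : ℝ × E n => |u z.1 z.2| ^ p)
    {z | 0 < z.1 ∧ (z.1 : EReal) < T}
  /-- initial position -/
  initial_position : u 0 =ᵐ[volume] fun x => ε * f x
  /-- initial velocity -/
  initial_velocity : V 0 =ᵐ[volume] fun x => ε * g x
  /-- the integral on the right-hand side of the weak formulation converges -/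
  integrable_nonlinearity : ∀ φ : ℝ × E n → ℝ, IsTestFunction T φ → ∀ t ∈ timeInterval T,
    IntegrableOn (fun z : ℝ × E n => |u z.1 z.2| ^ p * φ z) (Ioo 0 t ×ˢ univ)
  /-- the weak formulation -/
  weak_formulation : ∀ φ : ℝ × E n → ℝ, IsTestFunction T φ → ∀ t ∈ timeInterval T,
    (∫ x, V t x * φ (t, x)) - (∫ x, V 0 x * φ (0, x))
      + (∫ s in (0 : ℝ)..t, ∫ x, (-(V s x * deriv (fun r => φ (r, x)) s)
          + inner ℝ (G s x) (gradient (fun y => φ (s, y)) x)))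
      + (∫ s in (0 : ℝ)..t, ∫ x, μ * V s x / (1 + s) ^ β * φ (s, x))
      = ∫ s in (0 : ℝ)..t, ∫ x, |u s x| ^ p * φ (s, x)

/-- `u` is an energy solution over `[0, T)` of
`u_tt - Δu + μ (1 + t)^(-β) u_t = |u|^p`, `u(·, 0) = ε f`, `u_t(·, 0) = ε g` on `ℝⁿ`. -/
def IsEnergySolution {n : ℕ} (p μ β ε : ℝ) (f g : E n → ℝ) (T : EReal)
    (u : ℝ → E n → ℝ) : Prop :=
  ∃ U G V, IsEnergySolutionWith p μ β ε f g T u U G V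

/-- `supp u ⊆ {(x, t) ∈ ℝⁿ × [0, T) : |x| ≤ t + R}`, the support being that of a (class of)
functions defined almost everywhere. -/
def SupportedInCone {n : ℕ} (R : ℝ) (T : EReal) (u : ℝ → E n → ℝ) : Prop :=
  ∀ t ∈ timeInterval T, ∀ᵐ x, t + R < ‖x‖ → u t x = 0

end DampedWave

end

noncomputable section

namespace DampedWave

open scoped ENNReal

/-! Since `β > 1`, the damping is integrable in time: its integrating factor `m = multiplier μ β`
stays between `m 0 > 0` and `1` on `t ≥ 0`, so the damping costs only constants. The proof then
compares two lower bounds for the mean `F(t) = ∫ u(·, t)`, which satisfies `(m F')' = m ∫ |u|^p`.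
Write `k = n - 1`.

Linear bound: testing with `exp (x · ξ)` and dropping the nonnegative nonlinearity gives `(m h')' ≥
‖ξ‖² m h`, so `h` grows at least like `ε exp (‖ξ‖ t)` (`exp_lower_bound`, `planeWave_lower_bound`).
Hence `u` has averages of size at least `ε` against every plane wave `exp (x · ξ - ‖ξ‖ t)` with `1 ≤
‖ξ‖ ≤ 2`. On the cone slice such a wave has mass `O(t^(k/2))`, while its integral over the
frequencies is `O(t^(-k/2))` at each point. Hölder in `x` for fixed `ξ`, followed by integration in
`ξ`, yields `∫ |u|^p ≥ c ε^p t^(k (1 - p/2))` (`lintegral_rpow_lower_bound`). Two time integrations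
give `F(τ) ≥ c ε^p τ^(k (1 - p/2) + 2)`.

Nonlinear bound: Hölder on the cone slice gives `∫ |u|^p ≥ c t^(-n (p - 1)) F^p`. Thus `F` doubles
on time steps that shrink geometrically; if it starts too large at `τ`, it doubles infinitely often
before `2 τ` (`doubling_bound`). Existence up to `2 τ` therefore bounds `ε^(p (p - 1)) τ^(γ/2)`
(`exists_lifespan_constant`), and `γ > 0` turns this into the lifespan estimate. -/

/-! ### Ordinary differential inequalities -/

/-- Differentiability inside an interval of the primitive of a continuous function. -/
lemma hasDerivAt_primitive {k : ℝ → ℝ} {X t : ℝ} (hk : ContinuousOn k (Icc 0 X))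
    (ht : t ∈ Ioo 0 X) : HasDerivAt (fun r => ∫ s in (0 : ℝ)..r, k s) (k t) t := by
  apply intervalIntegral.integral_hasDerivAt_right
  · apply ContinuousOn.intervalIntegrable
    rw [uIcc_of_le ht.1.le]
    exact hk.mono (Icc_subset_Icc le_rfl ht.2.le)
  · exact (hk.mono Ioo_subset_Icc_self).stronglyMeasurableAtFilter isOpen_Ioo t ht
  · exact hk.continuousAt (Icc_mem_nhds ht.1 ht.2)

lemma continuousOn_primitive {k : ℝ → ℝ} {X : ℝ} (hX : 0 ≤ X) (hk : ContinuousOn k (Icc 0 X)) :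
    ContinuousOn (fun r => ∫ s in (0 : ℝ)..r, k s) (Icc 0 X) := by
  rw [← uIcc_of_le hX] at hk ⊢
  exact intervalIntegral.continuousOn_primitive_interval hk.integrableOn_uIcc

/-- A function stays positive if its derivative is nonnegative as long as it has been positive. -/
lemma pos_of_deriv_nonneg_of_pos {h v : ℝ → ℝ} {X : ℝ} (h0 : 0 < h 0)
    (hd : ∀ t ∈ Icc 0 X, HasDerivWithinAt h (v t) (Icc 0 X) t)
    (hv : ∀ t ∈ Icc 0 X, (∀ s ∈ Icc 0 t, 0 ≤ h s) → 0 ≤ v t) :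
    ∀ t ∈ Icc 0 X, 0 < h t := by
  have hc : ContinuousOn h (Icc 0 X) := fun t ht => (hd t ht).continuousWithinAt
  by_contra! hcon
  obtain ⟨t, ht, hneg⟩ := hcon
  -- At the first time `τ` where `h ≤ 0`, `h` has been nondecreasing on `[0, τ]`, so `h τ ≥ h 0 >
  -- 0`.
  set S : Set ℝ := Icc 0 X ∩ h ⁻¹' Iic 0 with hS
  have hSc : IsClosed S := hc.preimage_isClosed_of_isClosed isClosed_Icc isClosed_Iic
  have hSne : S.Nonempty := ⟨t, ht, hneg⟩
  have hSb : BddBelow S := ⟨0, fun s hs => hs.1.1⟩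
  have hmem := hSc.csInf_mem hSne hSb
  set τ := sInf S with hτ
  have hpos : ∀ s ∈ Ico 0 τ, 0 < h s := by
    intro s hs
    by_contra! hcon
    exact absurd (csInf_le hSb ⟨⟨hs.1, hs.2.le.trans hmem.1.2⟩, hcon⟩) (not_le.mpr hs.2)
  have hmono : MonotoneOn h (Icc 0 τ) := by
    apply monotoneOn_of_deriv_nonneg (convex_Icc 0 τ)
      (hc.mono (Icc_subset_Icc le_rfl hmem.1.2))
    · intro s hs
      rw [interior_Icc] at hs
      exact ((hd s ⟨hs.1.le, hs.2.le.trans hmem.1.2⟩).hasDerivAt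
        (Icc_mem_nhds hs.1 (hs.2.trans_le hmem.1.2))).differentiableAt.differentiableWithinAt
    · intro s hs
      rw [interior_Icc] at hs
      have hs' : s ∈ Icc 0 X := ⟨hs.1.le, hs.2.le.trans hmem.1.2⟩
      rw [((hd s hs').hasDerivAt (Icc_mem_nhds hs.1 (hs.2.trans_le hmem.1.2))).deriv]
      exact hv s hs' fun r hr => (hpos r ⟨hr.1, hr.2.trans_lt hs.2⟩).le
  have h1 := hmono ⟨le_rfl, hmem.1.1⟩ ⟨hmem.1.1, le_rfl⟩ hmem.1.1
  have h2 : h τ ≤ 0 := hmem.2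
  linarith

/-- The exponential lower bound for solutions of `(m h')' ≥ l² m h`, where `m` increases to a
limit `≤ 1` and `h(0) > 0`, `h'(0) ≥ 0`. -/
lemma exp_lower_bound {h v m m' : ℝ → ℝ} {l X : ℝ} (hl : 0 ≤ l)
    (h0 : 0 < h 0)
    (hd : ∀ t ∈ Icc 0 X, HasDerivWithinAt h (v t) (Icc 0 X) t)
    (hm : ∀ t ∈ Icc 0 X, HasDerivAt m (m' t) t) (hm' : ∀ t ∈ Icc 0 X, 0 ≤ m' t)
    (hm0 : ∀ t ∈ Icc 0 X, 0 < m t) (hm1 : ∀ t ∈ Icc 0 X, m t ≤ 1)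
    (hmv : ∀ t ∈ Icc 0 X, l ^ 2 * ∫ s in (0 : ℝ)..t, m s * h s ≤ m t * v t) :
    ∀ t ∈ Icc 0 X, m 0 / 2 * h 0 * Real.exp (l * t) ≤ h t := by
  intro t₀ ht₀
  have hX : 0 ≤ X := ht₀.1.trans ht₀.2
  have hc : ContinuousOn h (Icc 0 X) := fun t ht => (hd t ht).continuousWithinAt
  have hmc : ContinuousOn m (Icc 0 X) := fun t ht => (hm t ht).continuousAt.continuousWithinAt
  have hmh : ContinuousOn (fun s => m s * h s) (Icc 0 X) := hmc.mul hc
  have hpos : ∀ t ∈ Icc 0 X, 0 < h t := by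
    refine pos_of_deriv_nonneg_of_pos h0 hd fun t ht hnn => ?_
    have h1 : 0 ≤ m t * v t := by
      refine le_trans (mul_nonneg (sq_nonneg l) ?_) (hmv t ht)
      exact intervalIntegral.integral_nonneg ht.1 fun s hs =>
        mul_nonneg (hm0 s ⟨hs.1, hs.2.trans ht.2⟩).le (hnn s hs)
    exact nonneg_of_mul_nonneg_right h1 (hm0 t ht)
  -- The operator `∂² - l²` is factored as `(∂ + l)(∂ - l)` into two first-order steps. `Z` replaces
  -- `m v`, for which no differentiability is assumed.
  set Z : ℝ → ℝ := fun t => l ^ 2 * ∫ s in (0 : ℝ)..t, m s * h s with hZ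
  have hZnn : ∀ t ∈ Icc 0 X, 0 ≤ Z t := fun t ht => mul_nonneg (sq_nonneg l)
    (intervalIntegral.integral_nonneg ht.1 fun s hs =>
        mul_nonneg (hm0 s ⟨hs.1, hs.2.trans ht.2⟩).le (hpos s ⟨hs.1, hs.2.trans ht.2⟩).le)
  have hZv : ∀ t ∈ Icc 0 X, Z t ≤ v t := by
    intro t ht
    have h1 := hmv t ht
    have hv0 : 0 ≤ v t := nonneg_of_mul_nonneg_right ((hZnn t ht).trans h1) (hm0 t ht)
    calc Z t ≤ m t * v t := h1
      _ ≤ 1 * v t := mul_le_mul_of_nonneg_right (hm1 t ht) hv0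
      _ = v t := one_mul _
  have hZc : ContinuousOn Z (Icc 0 X) := (continuousOn_primitive hX hmh).const_smul (l ^ 2)
  have hdh : ∀ t ∈ Ioo 0 X, HasDerivAt h (v t) t := fun t ht =>
    (hd t (Ioo_subset_Icc_self ht)).hasDerivAt (Icc_mem_nhds ht.1 ht.2)
  have hZd : ∀ t ∈ Ioo 0 X, HasDerivAt Z (l ^ 2 * (m t * h t)) t := fun t ht =>
    (hasDerivAt_primitive hmh ht).const_mul (l ^ 2)
  -- `S = Z + l m h` grows at least like `exp (l t)`
  have hS : ∀ t ∈ Icc 0 X, l * m 0 * h 0 * Real.exp (l * t) ≤ Z t + l * (m t * h t) := by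
    have hmono : MonotoneOn (fun t => (Z t + l * (m t * h t)) * Real.exp (-(l * t))) (Icc 0 X) := by
      have hder : ∀ t ∈ Ioo 0 X, HasDerivAt
          (fun t => (Z t + l * (m t * h t)) * Real.exp (-(l * t)))
          ((l ^ 2 * (m t * h t) + l * (m' t * h t + m t * v t)) * Real.exp (-(l * t))
            + (Z t + l * (m t * h t)) * (Real.exp (-(l * t)) * (-(l * 1)))) t := fun t ht =>
        ((hZd t ht).add (((hm t (Ioo_subset_Icc_self ht)).mul (hdh t ht)).const_mul l)).mul
          (((hasDerivAt_id t).const_mul l).neg.exp)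
      apply monotoneOn_of_deriv_nonneg (convex_Icc 0 X)
      · exact (hZc.add (hmh.const_smul l)).mul (by fun_prop)
      · rw [interior_Icc]
        exact fun t ht => (hder t ht).differentiableAt.differentiableWithinAt
      · rw [interior_Icc]
        intro t ht
        have ht' := Ioo_subset_Icc_self ht
        rw [(hder t ht).deriv]
        have h1 : 0 ≤ l * (m' t * h t) := mul_nonneg hl (mul_nonneg (hm' t ht') (hpos t ht').le)
        have h2 : 0 ≤ l * (m t * v t - Z t) := mul_nonneg hl (sub_nonneg.mpr (hmv t ht'))
        have h3 := mul_nonneg (add_nonneg h1 h2) (Real.exp_pos (-(l * t))).le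
        linear_combination h3
    intro t ht
    have h1 := hmono ⟨le_rfl, hX⟩ ht ht.1
    simp only [hZ, intervalIntegral.integral_same, mul_zero, neg_zero, Real.exp_zero, zero_add,
      mul_one] at h1
    rw [Real.exp_neg, ← div_eq_mul_inv, le_div_iff₀ (Real.exp_pos _)] at h1
    calc _ = l * (m 0 * h 0) * Real.exp (l * t) := by ring
      _ ≤ _ := h1
  -- Second factor: `(exp (l t) h)' = exp (l t) (v + l h) ≥ l m(0) h(0) exp (2 l t)`. Integrating
  -- the right side produces the factor `1/2`.
  have hmono : MonotoneOn (fun t => Real.exp (l * t) * h t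
      - m 0 / 2 * h 0 * Real.exp (2 * l * t)) (Icc 0 X) := by
    have hder : ∀ t ∈ Ioo 0 X, HasDerivAt (fun t => Real.exp (l * t) * h t
        - m 0 / 2 * h 0 * Real.exp (2 * l * t))
        (Real.exp (l * t) * (l * 1) * h t + Real.exp (l * t) * v t
          - m 0 / 2 * h 0 * (Real.exp (2 * l * t) * (2 * l * 1))) t := fun t ht =>
      (((((hasDerivAt_id t).const_mul l).exp).mul (hdh t ht))).sub
        ((((hasDerivAt_id t).const_mul (2 * l)).exp).const_mul (m 0 / 2 * h 0))
    apply monotoneOn_of_deriv_nonneg (convex_Icc 0 X)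
    · exact (ContinuousOn.mul (by fun_prop) hc).sub (by fun_prop)
    · rw [interior_Icc]
      exact fun t ht => (hder t ht).differentiableAt.differentiableWithinAt
    · rw [interior_Icc]
      intro t ht
      have ht' := Ioo_subset_Icc_self ht
      rw [(hder t ht).deriv]
      have h1 : l * (m t * h t) ≤ l * h t := by
        apply mul_le_mul_of_nonneg_left _ hl
        nlinarith [hm1 t ht', hpos t ht']
      have h2 := hS t ht'
      have h3 := hZv t ht'
      have h4 : Real.exp (2 * l * t) = Real.exp (l * t) * Real.exp (l * t) := by
        rw [← Real.exp_add]; ring_nf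
      have h5 := mul_nonneg (sub_nonneg.mpr (h2.trans (add_le_add h3 h1)))
        (Real.exp_pos (l * t)).le
      rw [h4]
      linear_combination h5
  have h1 := hmono ⟨le_rfl, hX⟩ ht₀ ht₀.1
  simp only [mul_zero, Real.exp_zero, one_mul, mul_one] at h1
  have h4 : Real.exp (2 * l * t₀) = Real.exp (l * t₀) * Real.exp (l * t₀) := by
    rw [← Real.exp_add]; ring_nf
  rw [h4] at h1
  have h6 : m 0 / 2 * h 0 ≤ h 0 := by
    have := hm1 0 ⟨le_rfl, hX⟩
    nlinarith
  have h7 : Real.exp (l * t₀) * (m 0 / 2 * h 0 * Real.exp (l * t₀)) ≤ Real.exp (l * t₀) * h t₀ := by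
    linarith
  exact le_of_mul_le_mul_left h7 (Real.exp_pos _)

/-- A function which, once above `M`, grows at least like `B M ^ p t ^ 2 / 2`, cannot live long. -/
lemma doubling_bound {F : ℝ → ℝ} {p A B a L : ℝ} (hp : 1 < p) (hA : 0 < A) (hB : 0 < B)
    (hL : 0 ≤ L) (hFa : A ≤ F a)
    (hgrow : ∀ s t M, a ≤ s → s ≤ t → t ≤ a + L → 0 < M → M ≤ F s →
      M ≤ F t ∧ B * M ^ p * (t - s) ^ 2 / 2 ≤ F t) :
    B * A ^ (p - 1) * L ^ 2 < (2 / (1 - 2 ^ (-((p - 1) / 2)))) ^ 2 := by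
  by_contra! hcon
  -- The `k`-th doubling, from `2^k A` to `2^(k+1) A`, takes time `d r^k`. The gain is `2^k A · (K
  -- d² / 2) · (2^(p-1) r²)^k`, so `r² = 2^(1-p)` and `K d² = 4` make it exactly `2^(k+1) A`. The
  -- total time `d / (1 - r)` fits into `L` precisely when the claimed bound fails.
  set r : ℝ := 2 ^ (-((p - 1) / 2)) with hr
  have hr0 : 0 < r := by positivity
  have hr1 : r < 1 := Real.rpow_lt_one_of_one_lt_of_neg (by norm_num) (by linarith)
  set K : ℝ := B * A ^ (p - 1) with hK
  have hK0 : 0 < K := by positivity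
  set d : ℝ := 2 / √K with hd
  have hd0 : 0 < d := by positivity
  have hd2 : d ^ 2 = 4 / K := by
    rw [hd, div_pow, Real.sq_sqrt hK0.le]; norm_num
  have hdL : d / (1 - r) ≤ L := by
    have h1 : 0 < 1 - r := by linarith
    have h2 : (2 / (1 - r)) ≤ √K * L := by
      rw [← Real.sqrt_sq hL, ← Real.sqrt_mul hK0.le]
      exact Real.le_sqrt_of_sq_le hcon
    rw [hd, div_div, mul_comm, ← div_div, div_le_iff₀ (by positivity)]
    linarith
  let t : ℕ → ℝ := fun k => a + d * ∑ i ∈ Finset.range k, r ^ i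
  have htL : ∀ k, t k ≤ a + L := by
    intro k
    have h1 : ∑ i ∈ Finset.range k, r ^ i ≤ 1 / (1 - r) := by
      rw [geom_sum_eq hr1.ne, ← neg_div_neg_eq]
      apply div_le_div_of_nonneg_right _ (by linarith)
        |>.trans_eq
      · congr 1; ring
      · have := pow_pos hr0 k; linarith
    have h2 := mul_le_mul_of_nonneg_left h1 hd0.le
    rw [mul_one_div] at h2
    simp only [t]; linarith
  have hta : ∀ k, a ≤ t k := fun k => by
    have : 0 ≤ d * ∑ i ∈ Finset.range k, r ^ i := by positivity
    simp only [t]; linarith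
  have hstep : ∀ k, t (k + 1) - t k = d * r ^ k := fun k => by
    simp only [t, Finset.sum_range_succ]; ring
  have hr2 : r ^ 2 = 2 ^ (1 - p) := by
    rw [hr, ← Real.rpow_natCast, ← Real.rpow_mul (by norm_num)]
    congr 1; push_cast; ring
  have hF : ∀ k : ℕ, 2 ^ k * A ≤ F (t k) := by
    intro k
    induction k with
    | zero => simpa [t] using hFa
    | succ k ih =>
      have h1 := (hgrow (t k) (t (k + 1)) (2 ^ k * A) (hta k)
        (by have := hstep k; have : 0 < d * r ^ k := by positivity
            linarith) (htL _) (by positivity) ih).2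
      refine le_trans (le_of_eq ?_) h1
      have h3 : ((2 : ℝ) ^ k) ^ p = 2 ^ k * ((2 : ℝ) ^ (p - 1)) ^ k := by
        have e : p = 1 + (p - 1) := by ring
        conv_lhs => rw [e]
        rw [Real.rpow_add (by positivity), Real.rpow_one, ← Real.rpow_natCast,
          ← Real.rpow_mul (by norm_num), ← Real.rpow_natCast ((2 : ℝ) ^ (p - 1)),
          ← Real.rpow_mul (by norm_num)]
        congr 2; ring
      have h4 : A ^ p = A * A ^ (p - 1) := by
        have e : p = 1 + (p - 1) := by ring
        conv_lhs => rw [e]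
        rw [Real.rpow_add hA, Real.rpow_one]
      have h5 : ((2 : ℝ) ^ (p - 1)) ^ k * (r ^ k) ^ 2 = 1 := by
        rw [← pow_mul, mul_comm k 2, pow_mul, hr2, ← mul_pow, ← Real.rpow_add (by norm_num)]
        simp
      have h6 : B * A ^ (p - 1) * d ^ 2 = 4 := by
        rw [hd2, ← hK]; field_simp
      rw [hstep, Real.mul_rpow (by positivity) hA.le, h3, h4, pow_succ]
      linear_combination (-(2 ^ k * A / 2 * ((2 ^ (p - 1)) ^ k * (r ^ k) ^ 2))) * h6
        - 2 ^ k * A * 2 * h5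
  have hfin : ∀ k : ℕ, 2 ^ k * A ≤ F (a + L) := fun k =>
    (hgrow (t k) (a + L) (2 ^ k * A) (hta k) (htL k) le_rfl (by positivity) (hF k)).1
  obtain ⟨k, hk⟩ := pow_unbounded_of_one_lt (F (a + L) / A) (by norm_num : (1 : ℝ) < 2)
  rw [div_lt_iff₀ hA] at hk
  exact absurd (hfin k) (not_le.mpr hk)

/-! ### Plane waves on balls and on frequency annuli -/

/-- Integrals of a product of a function of one coordinate and a Gaussian in the orthogonal
directions. -/
lemma integral_slab {k : ℕ} {e : E (k + 1)} (he : ‖e‖ = 1) {b : ℝ} (hb : 0 < b) {h : ℝ → ℝ}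
    (hh : Integrable h) :
    Integrable (fun x : E (k + 1) =>
      h (inner ℝ e x) * Real.exp (-b * (‖x‖ ^ 2 - inner ℝ e x ^ 2))) ∧
    ∫ x : E (k + 1), h (inner ℝ e x) * Real.exp (-b * (‖x‖ ^ 2 - inner ℝ e x ^ 2))
      = (∫ y, h y) * √(Real.pi / b) ^ k := by
  -- In an orthonormal basis starting with `e`, `‖x‖² - ⟪e, x⟫²` is the sum of the other `k` squared
  -- coordinates, so the integrand is a product of functions of one variable.
  have hv : Orthonormal ℝ (({0} : Set (Fin (k + 1))).domRestrict fun _ => e) := by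
    refine ⟨fun _ => he, fun i j hij => ?_⟩
    exact absurd (Subsingleton.elim i j) hij
  obtain ⟨B, hB⟩ := hv.exists_orthonormalBasis_extension_of_card_eq (by simp)
  have hB0 : B 0 = e := hB 0 rfl
  let φ : Fin (k + 1) → ℝ → ℝ := Fin.cons h fun _ y => Real.exp (-b * y ^ 2)
  have hkey : ∀ y : Fin (k + 1) → ℝ,
      h (inner ℝ e (B.repr.symm (WithLp.toLp 2 y)))
        * Real.exp (-b * (‖B.repr.symm (WithLp.toLp 2 y)‖ ^ 2
          - inner ℝ e (B.repr.symm (WithLp.toLp 2 y)) ^ 2)) = ∏ i, φ i (y i) := by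
    intro y
    have h1 : inner ℝ e (B.repr.symm (WithLp.toLp 2 y)) = y 0 := by
      rw [← hB0, ← B.repr_apply_apply]; simp
    rw [h1, LinearIsometryEquiv.norm_map, EuclideanSpace.norm_sq_eq, Fin.sum_univ_succ,
      Fin.prod_univ_succ]
    simp only [Real.norm_eq_abs, sq_abs, φ, Fin.cons_zero, Fin.cons_succ, add_sub_cancel_left]
    rw [Finset.mul_sum, Real.exp_sum]
  have hφ : ∀ i, Integrable (φ i) := by
    intro i
    refine Fin.cases ?_ (fun j => ?_) i
    · simpa [φ] using hh
    · simpa [φ] using integrable_exp_neg_mul_sq hb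
  have mp : MeasurePreserving (fun y : Fin (k + 1) → ℝ => B.repr.symm (WithLp.toLp 2 y)) :=
    B.measurePreserving_repr_symm.comp (PiLp.volume_preserving_toLp _)
  have me : MeasurableEmbedding (fun y : Fin (k + 1) → ℝ => B.repr.symm (WithLp.toLp 2 y)) :=
    B.repr.symm.toHomeomorph.measurableEmbedding.comp
      (MeasurableEquiv.toLp 2 (Fin (k + 1) → ℝ)).measurableEmbedding
  constructor
  · rw [← mp.integrable_comp_emb me]
    simp only [Function.comp_def, hkey]
    exact Integrable.fintype_prod hφ
  · rw [← mp.integral_comp me]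
    simp only [hkey]
    rw [integral_fintype_prod_volume_eq_prod, Fin.prod_univ_succ]
    simp only [φ, Fin.cons_zero, Fin.cons_succ, integral_gaussian, Finset.prod_const,
      Finset.card_univ, Fintype.card_fin]

/-- `lintegral` version of `integral_slab`. -/
lemma lintegral_slab {k : ℕ} {e : E (k + 1)} (he : ‖e‖ = 1) {b : ℝ} (hb : 0 < b) {h : ℝ → ℝ}
    (hh : Integrable h) (hh0 : ∀ y, 0 ≤ h y) :
    ∫⁻ x : E (k + 1), ENNReal.ofReal
      (h (inner ℝ e x) * Real.exp (-b * (‖x‖ ^ 2 - inner ℝ e x ^ 2)))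
      = ENNReal.ofReal ((∫ y, h y) * √(Real.pi / b) ^ k) := by
  rw [← (integral_slab he hb hh).2, ofReal_integral_eq_lintegral_ofReal (integral_slab he hb hh).1]
  exact .of_forall fun x => mul_nonneg (hh0 _) (Real.exp_pos _).le

/-- The integral of a plane wave over a slice of the light cone. -/
lemma lintegral_planeWave_ball_le {k : ℕ} {ξ : E (k + 1)} (h1 : 1 ≤ ‖ξ‖) (h2 : ‖ξ‖ ≤ 2)
    {t R : ℝ} (ht : 0 ≤ t) (hR : 0 < R) :
    ∫⁻ x in Metric.closedBall (0 : E (k + 1)) (t + R),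
      ENNReal.ofReal (Real.exp (inner ℝ x ξ - ‖ξ‖ * t))
      ≤ ENNReal.ofReal (Real.exp (2 * R) * (2 * √(Real.pi / (1 / (4 * (t + R)))) ^ k)) := by
  set ρ := t + R with hρ
  have hρ0 : 0 < ρ := by positivity
  have hξ0 : ‖ξ‖ ≠ 0 := by linarith
  set e : E (k + 1) := ‖ξ‖⁻¹ • ξ with he
  have he1 : ‖e‖ = 1 := by rw [he, norm_smul, norm_inv, norm_norm, inv_mul_cancel₀ hξ0]
  -- With `y = ⟪e, x⟫`, the exponent is at most `2 R - (ρ - y)`. Half of `ρ - y` is kept in `h`; the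
  -- other half dominates `(‖x‖² - y²) / (4 ρ)`, because `‖x‖² - y² ≤ ρ² - y² ≤ 2 ρ (ρ - y)` in the
  -- ball. This leaves a Gaussian of width `√ρ` in the `k` orthogonal directions.
  let h : ℝ → ℝ := (Iic ρ).indicator fun y => Real.exp ((1 / 2) * (y - ρ))
  have hexp : (fun y => Real.exp ((1 / 2) * (y - ρ)))
      = fun y => Real.exp (-(ρ / 2)) * Real.exp ((1 / 2) * y) := by
    ext y; rw [← Real.exp_add]; ring_nf
  have hh : Integrable h := by
    rw [integrable_indicator_iff measurableSet_Iic, hexp]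
    exact (integrableOn_exp_mul_Iic (by norm_num) ρ).const_mul _
  have hint : ∫ y, h y = 2 := by
    rw [integral_indicator measurableSet_Iic, hexp, integral_const_mul,
      integral_exp_mul_Iic (by norm_num)]
    rw [← mul_div_assoc, ← Real.exp_add]
    ring_nf; simp
  have hh0 : ∀ y, 0 ≤ h y := fun y => indicator_nonneg (fun _ _ => (Real.exp_pos _).le) y
  have hb : (0 : ℝ) < 1 / (4 * ρ) := by positivity
  have hsl := lintegral_slab he1 hb hh hh0
  rw [hint] at hsl
  rw [ENNReal.ofReal_mul (Real.exp_pos _).le, ← hsl,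
    ← lintegral_const_mul' _ _ ENNReal.ofReal_ne_top,
    ← lintegral_indicator Metric.isClosed_closedBall.measurableSet]
  refine lintegral_mono fun x => ?_
  by_cases hx : x ∈ Metric.closedBall (0 : E (k + 1)) ρ
  swap
  · rw [indicator_of_notMem hx]; exact zero_le
  rw [indicator_of_mem hx, ← ENNReal.ofReal_mul (Real.exp_pos _).le]
  apply ENNReal.ofReal_le_ofReal
  rw [mem_closedBall_zero_iff] at hx
  set y := inner ℝ e x with hy
  have hyx : |y| ≤ ‖x‖ := by
    have := abs_real_inner_le_norm e x
    rwa [he1, one_mul] at this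
  have hyρ : y ≤ ρ := (le_abs_self y).trans (hyx.trans hx)
  have hyρ' : -ρ ≤ y := by linarith [neg_abs_le y]
  have hin : inner ℝ x ξ = ‖ξ‖ * y := by
    rw [hy, he, real_inner_smul_left, ← mul_assoc, mul_inv_cancel₀ hξ0, one_mul,
      real_inner_comm]
  have hhy : h y = Real.exp ((1 / 2) * (y - ρ)) := indicator_of_mem (by exact hyρ) _
  rw [hhy, ← Real.exp_add, ← Real.exp_add, hin]
  apply Real.exp_le_exp.mpr
  have hq : 1 / (4 * ρ) * (‖x‖ ^ 2 - y ^ 2) ≤ (ρ - y) / 2 := by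
    rw [one_div, ← div_eq_inv_mul, div_le_iff₀ (by positivity)]
    nlinarith [norm_nonneg x, mul_nonneg (sub_nonneg.mpr hyρ) (sub_nonneg.mpr hyρ)]
  have hq2 : ‖ξ‖ * (y - ρ) ≤ 1 * (y - ρ) := mul_le_mul_of_nonpos_right h1 (by linarith)
  have hq3 : ‖ξ‖ * R ≤ 2 * R := mul_le_mul_of_nonneg_right h2 hR.le
  have : ‖ξ‖ * t = ‖ξ‖ * ρ - ‖ξ‖ * R := by rw [hρ]; ring
  linarith

/-- Averaging plane waves over an annulus of frequencies yields decay. -/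
lemma lintegral_planeWave_annulus_le {k : ℕ} {x : E (k + 1)} {t R : ℝ} (ht : 0 < t) (hR : 0 ≤ R)
    (hx : ‖x‖ ≤ t + R) :
    ∫⁻ ξ in {ξ : E (k + 1) | 1 ≤ ‖ξ‖ ∧ ‖ξ‖ ≤ 2},
      ENNReal.ofReal (Real.exp (inner ℝ x ξ - ‖ξ‖ * t))
      ≤ ENNReal.ofReal (Real.exp (2 * R) * (4 * √(Real.pi / (t / 4)) ^ k)) := by
  obtain ⟨e, he1, hex⟩ : ∃ e : E (k + 1), ‖e‖ = 1 ∧ x = ‖x‖ • e := by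
    by_cases h0 : x = 0
    · obtain ⟨e, he⟩ := exists_norm_eq (E (k + 1)) (zero_le_one' ℝ)
      exact ⟨e, he, by simp [h0]⟩
    · have h0' : ‖x‖ ≠ 0 := by simpa using h0
      exact ⟨‖x‖⁻¹ • x, by rw [norm_smul, norm_inv, norm_norm, inv_mul_cancel₀ h0'],
        by rw [smul_smul, mul_inv_cancel₀ h0', one_smul]⟩
  let h : ℝ → ℝ := (Icc (-2) 2).indicator fun _ => 1
  have hh : Integrable h := by
    rw [integrable_indicator_iff measurableSet_Icc]
    exact integrableOn_const (by simp)
  have hint : ∫ y, h y = 4 := by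
    rw [integral_indicator measurableSet_Icc]
    simp; norm_num
  have hh0 : ∀ y, 0 ≤ h y := fun y => indicator_nonneg (fun _ _ => zero_le_one) y
  have hms : MeasurableSet {ξ : E (k + 1) | 1 ≤ ‖ξ‖ ∧ ‖ξ‖ ≤ 2} :=
    (measurableSet_le measurable_const measurable_norm).inter
      (measurableSet_le measurable_norm measurable_const)
  have hsl := lintegral_slab he1 (by positivity : 0 < t / 4) hh hh0
  rw [hint] at hsl
  rw [ENNReal.ofReal_mul (Real.exp_pos _).le, ← hsl,
    ← lintegral_const_mul' _ _ ENNReal.ofReal_ne_top, ← lintegral_indicator hms]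
  refine lintegral_mono fun ξ => ?_
  by_cases hξ : ξ ∈ {ξ : E (k + 1) | 1 ≤ ‖ξ‖ ∧ ‖ξ‖ ≤ 2}
  swap
  · rw [indicator_of_notMem hξ]; exact zero_le
  rw [indicator_of_mem hξ, ← ENNReal.ofReal_mul (Real.exp_pos _).le]
  apply ENNReal.ofReal_le_ofReal
  set y := inner ℝ e ξ with hy
  have hyx : |y| ≤ ‖ξ‖ := by
    have := abs_real_inner_le_norm e ξ
    rwa [he1, one_mul] at this
  have hyl := abs_le.mp hyx
  obtain ⟨hξ1, hξ2⟩ := hξ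
  have hin : inner ℝ x ξ = ‖x‖ * y := by
    conv_lhs => rw [hex]
    rw [real_inner_smul_left]
  have hhy : h y = 1 := indicator_of_mem (by constructor <;> linarith) _
  rw [hhy, one_mul, ← Real.exp_add, hin]
  apply Real.exp_le_exp.mpr
  -- For `y ≥ 0` the exponent is at most `2 R - t (‖ξ‖ - y)`, and `‖ξ‖ - y ≥ (‖ξ‖² - y²) / 4` since
  -- `‖ξ‖ + y ≤ 4`. For `y < 0` the term `-‖ξ‖ t` alone suffices, as `‖ξ‖² ≤ 2 ‖ξ‖`.
  rcases le_or_gt 0 y with hy0 | hy0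
  · have a1 : ‖x‖ * y ≤ (t + R) * y := mul_le_mul_of_nonneg_right hx hy0
    have a2 : R * y ≤ R * 2 := mul_le_mul_of_nonneg_left (by linarith) hR
    have a3 : t * ((‖ξ‖ - y) * (‖ξ‖ + y)) ≤ t * ((‖ξ‖ - y) * 4) :=
      mul_le_mul_of_nonneg_left (mul_le_mul_of_nonneg_left (by linarith) (by linarith)) ht.le
    nlinarith
  · have a1 : ‖x‖ * y ≤ 0 := mul_nonpos_of_nonneg_of_nonpos (norm_nonneg x) hy0.le
    have a2 : t * (‖ξ‖ * ‖ξ‖) ≤ t * (2 * ‖ξ‖) :=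
      mul_le_mul_of_nonneg_left (mul_le_mul_of_nonneg_right hξ2 (norm_nonneg _)) ht.le
    have a3 : 0 ≤ t * ‖ξ‖ := by positivity
    have a4 : 0 ≤ t * y ^ 2 := by positivity
    nlinarith

/-! ### Hölder's inequality with plane-wave weights -/

/-- Hölder's inequality on a finite measure space, in `p`-th powers. -/
lemma lintegral_rpow_le {α : Type*} [MeasurableSpace α] (ν : Measure α) {p : ℝ} (hp : 1 < p)
    {w : α → ℝ≥0∞} (hw : AEMeasurable w ν) :
    (∫⁻ x, w x ∂ν) ^ p ≤ (∫⁻ x, w x ^ p ∂ν) * ν univ ^ (p - 1) := by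
  have hpq := Real.HolderConjugate.conjExponent hp
  have h1 := ENNReal.lintegral_mul_le_Lp_mul_Lq ν hpq hw (g := fun _ => 1) aemeasurable_const
  simp only [Pi.mul_apply, mul_one, ENNReal.one_rpow, lintegral_const, one_mul] at h1
  have h2 := ENNReal.rpow_le_rpow h1 (by linarith : 0 ≤ p)
  refine h2.trans (le_of_eq ?_)
  rw [ENNReal.mul_rpow_of_nonneg _ _ (by linarith), ← ENNReal.rpow_mul, ← ENNReal.rpow_mul,
    one_div_mul_cancel (by linarith), ENNReal.rpow_one]
  congr 2
  rw [Real.conjExponent]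
  have : p ≠ 0 := by linarith
  have : p - 1 ≠ 0 := by linarith
  field_simp

/-- If all plane wave averages of a function supported in a slice of the cone are bounded below,
so is its `L^p` norm, with a gain from the dispersion of plane waves. -/
lemma lintegral_rpow_lower_bound {k : ℕ} {p t R : ℝ} (hp : 1 < p) (ht : 0 < t) (hR : 0 < R)
    {w : E (k + 1) → ℝ≥0∞} (hw : AEMeasurable w) (hwR : ∀ᵐ x, t + R < ‖x‖ → w x = 0)
    {c : ℝ≥0∞} (hc : ∀ ξ : E (k + 1), 1 ≤ ‖ξ‖ → ‖ξ‖ ≤ 2 →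
      c ≤ ∫⁻ x, w x * ENNReal.ofReal (Real.exp (inner ℝ x ξ - ‖ξ‖ * t))) :
    c ^ p * volume {ξ : E (k + 1) | 1 ≤ ‖ξ‖ ∧ ‖ξ‖ ≤ 2} ≤
      (∫⁻ x, w x ^ p)
        * ENNReal.ofReal (Real.exp (2 * R) * (4 * √(Real.pi / (t / 4)) ^ k))
        * ENNReal.ofReal (Real.exp (2 * R) * (2 * √(Real.pi / (1 / (4 * (t + R)))) ^ k))
          ^ (p - 1) := by
  set A := {ξ : E (k + 1) | 1 ≤ ‖ξ‖ ∧ ‖ξ‖ ≤ 2} with hA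
  set CA := ENNReal.ofReal (Real.exp (2 * R) * (2 * √(Real.pi / (1 / (4 * (t + R)))) ^ k))
  set CB := ENNReal.ofReal (Real.exp (2 * R) * (4 * √(Real.pi / (t / 4)) ^ k))
  have hms : MeasurableSet A :=
    (measurableSet_le measurable_const measurable_norm).inter
      (measurableSet_le measurable_norm measurable_const)
  let pw : E (k + 1) → E (k + 1) → ℝ≥0∞ := fun ξ x =>
    ENNReal.ofReal (Real.exp (inner ℝ x ξ - ‖ξ‖ * t))
  have hpw : ∀ ξ, Measurable (pw ξ) := fun ξ => by fun_prop
  set S := Metric.closedBall (0 : E (k + 1)) (t + R)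
  have hS : MeasurableSet S := Metric.isClosed_closedBall.measurableSet
  have hrestr : ∀ (F : E (k + 1) → ℝ≥0∞), (∀ᵐ x, t + R < ‖x‖ → F x = 0) →
      ∫⁻ x, F x = ∫⁻ x in S, F x := by
    intro F hF
    rw [← lintegral_indicator hS]
    refine lintegral_congr_ae ?_
    filter_upwards [hF] with x hx
    by_cases hxS : x ∈ S
    · rw [indicator_of_mem hxS]
    · rw [indicator_of_notMem hxS]
      exact hx (by simpa [S] using hxS)
  -- For each fixed `ξ`, Hölder is applied in the measure with density the plane wave on the slice,
  -- whose mass is at most `CA`.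
  have step : ∀ ξ ∈ A, c ^ p ≤ (∫⁻ x in S, w x ^ p * pw ξ x) * CA ^ (p - 1) := by
    intro ξ hξ
    have h1 := hc ξ hξ.1 hξ.2
    rw [hrestr _ (by filter_upwards [hwR] with x hx h; rw [hx h, zero_mul])] at h1
    set ν := (volume.restrict S).withDensity (pw ξ) with hν
    have e1 : ∫⁻ x in S, w x * pw ξ x = ∫⁻ x, w x ∂ν := by
      rw [hν, lintegral_withDensity_eq_lintegral_mul₀ (hpw ξ).aemeasurable hw.restrict]
      simp only [Pi.mul_apply, mul_comm]
    have e2 : ∫⁻ x in S, w x ^ p * pw ξ x = ∫⁻ x, w x ^ p ∂ν := by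
      rw [hν, lintegral_withDensity_eq_lintegral_mul₀ (hpw ξ).aemeasurable
        (hw.restrict.pow_const p)]
      simp only [Pi.mul_apply, mul_comm]
    have e3 : ν univ ≤ CA := by
      rw [hν, withDensity_apply _ MeasurableSet.univ, Measure.restrict_univ]
      exact lintegral_planeWave_ball_le hξ.1 hξ.2 ht.le hR
    calc c ^ p ≤ (∫⁻ x, w x ∂ν) ^ p :=
          ENNReal.rpow_le_rpow (h1.trans e1.le) (by linarith)
      _ ≤ (∫⁻ x, w x ^ p ∂ν) * ν univ ^ (p - 1) := by
          refine lintegral_rpow_le ν hp ?_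
          exact hw.restrict.mono_ac (withDensity_absolutelyContinuous _ _)
      _ ≤ _ := by
          rw [e2]
          gcongr
  calc c ^ p * volume A = ∫⁻ ξ in A, c ^ p := by rw [setLIntegral_const]
    _ ≤ ∫⁻ ξ in A, (∫⁻ x in S, w x ^ p * pw ξ x) * CA ^ (p - 1) := setLIntegral_mono' hms step
    _ = (∫⁻ ξ in A, ∫⁻ x in S, w x ^ p * pw ξ x) * CA ^ (p - 1) := by
        rw [lintegral_mul_const' _ _ (ENNReal.rpow_ne_top_of_nonneg (by linarith)
          ENNReal.ofReal_ne_top)]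
    -- After Hölder the right side is linear in the plane wave, so Tonelli lets the frequency
    -- average act on it pointwise in `x`; its decay is the gain `CB`.
    _ = (∫⁻ x in S, ∫⁻ ξ in A, w x ^ p * pw ξ x) * CA ^ (p - 1) := by
        rw [lintegral_lintegral_swap]
        refine AEMeasurable.mul ((hw.restrict.pow_const p).comp_snd) ?_
        exact Measurable.aemeasurable (by simp only [pw]; fun_prop)
    _ ≤ (∫⁻ x in S, w x ^ p * CB) * CA ^ (p - 1) := by
        gcongr ?_ * _
        refine setLIntegral_mono' hS fun x hx => ?_
        rw [lintegral_const_mul _ (by simp only [pw]; fun_prop)]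
        gcongr
        exact lintegral_planeWave_annulus_le ht hR.le (by simpa [S] using hx)
    _ ≤ _ := by
        gcongr ?_ * _
        rw [lintegral_mul_const' _ _ ENNReal.ofReal_ne_top]
        gcongr
        exact Measure.restrict_le_self

/-! ### The integrating factor for the damping -/

/-- The multiplier `exp (μ (1 + t)^(1 - β) / (1 - β))`, an integrating factor for the damping. -/
def multiplier (μ β t : ℝ) : ℝ := Real.exp (μ / (1 - β) * (1 + t) ^ (1 - β))

lemma multiplier_pos (μ β t : ℝ) : 0 < multiplier μ β t := Real.exp_pos _

/-- For `β > 1` the exponent is nonpositive. Together with `multiplier_mono` this traps the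
multiplier between its value at `0` and `1`. -/
lemma multiplier_le_one {μ β t : ℝ} (hμ : 0 < μ) (hβ : 1 < β) (ht : 0 ≤ t) :
    multiplier μ β t ≤ 1 := by
  rw [multiplier, Real.exp_le_one_iff]
  exact mul_nonpos_of_nonpos_of_nonneg
    (div_nonpos_of_nonneg_of_nonpos hμ.le (by linarith)) (by positivity)

lemma hasDerivAt_multiplier (μ : ℝ) {β t : ℝ} (hβ : 1 < β) (ht : -1 < t) :
    HasDerivAt (multiplier μ β) (μ / (1 + t) ^ β * multiplier μ β t) t := by
  have h0 : (0 : ℝ) < 1 + t := by linarith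
  have h1 : HasDerivAt (fun t : ℝ => (1 + t) ^ (1 - β)) (1 * (1 - β) * (1 + t) ^ (1 - β - 1)) t :=
    ((hasDerivAt_id t).const_add 1).rpow_const (Or.inl h0.ne')
  have h2 := (h1.const_mul (μ / (1 - β))).exp
  refine h2.congr_deriv ?_
  have h3 : (1 + t) ^ (1 - β - 1) = ((1 + t) ^ β)⁻¹ := by
    rw [← Real.rpow_neg h0.le]; congr 1; ring
  have h4 : 1 - β ≠ 0 := by linarith
  rw [h3, multiplier]
  field_simp

lemma contDiffAt_multiplier (μ β : ℝ) {t : ℝ} (ht : -1 < t) :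
    ContDiffAt ℝ ∞ (multiplier μ β) t := by
  have h0 : (1 : ℝ) + t ≠ 0 := by linarith
  exact (contDiffAt_const.mul
    ((contDiffAt_const.add contDiffAt_id).rpow_const_of_ne h0)).exp

lemma multiplier_mono {μ β s t : ℝ} (hμ : 0 < μ) (hβ : 1 < β) (hs : 0 ≤ s) (hst : s ≤ t) :
    multiplier μ β s ≤ multiplier μ β t := by
  apply Real.exp_le_exp.mpr
  apply mul_le_mul_of_nonpos_left _ (div_nonpos_of_nonneg_of_nonpos hμ.le (by linarith))
  exact Real.rpow_le_rpow_of_nonpos (by linarith) (by linarith) (by linarith)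

/-! ### Pairing curves in `L²` with fixed functions -/

section Pairing

variable {n : ℕ}

/-- Exhibits the pairing as a bounded linear functional on `L²`, so continuity and differentiability
of `U` and `V` pass to scalar functions. -/
lemma integral_mul_eq_inner {η : E n → ℝ} (hη : MemLp η 2) (W : Lp ℝ 2 (volume : Measure (E n))) :
    ∫ x, W x * η x = inner ℝ (hη.toLp η) W := by
  rw [L2.inner_def]
  refine integral_congr_ae ?_
  filter_upwards [hη.coeFn_toLp] with x hx
  rw [hx]; simp

lemma hasDerivWithinAt_pairing {η : E n → ℝ} (hη : MemLp η 2)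
    {U : ℝ → Lp ℝ 2 (volume : Measure (E n))} {U' : Lp ℝ 2 (volume : Measure (E n))}
    {S : Set ℝ} {t : ℝ} (h : HasDerivWithinAt U U' S t) :
    HasDerivWithinAt (fun s => ∫ x, U s x * η x) (∫ x, U' x * η x) S t := by
  simp only [integral_mul_eq_inner hη]
  exact ((innerSL ℝ (hη.toLp η)).hasFDerivAt.comp_hasDerivWithinAt t h)

lemma continuousOn_pairing {η : E n → ℝ} (hη : MemLp η 2)
    {V : ℝ → Lp ℝ 2 (volume : Measure (E n))} {S : Set ℝ} (h : ContinuousOn V S) :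
    ContinuousOn (fun s => ∫ x, V s x * η x) S := by
  simp only [integral_mul_eq_inner hη]
  exact (innerSL ℝ (hη.toLp η)).continuous.comp_continuousOn h

lemma integrable_pairing {η : E n → ℝ} (hη : MemLp η 2) (W : Lp ℝ 2 (volume : Measure (E n))) :
    Integrable (fun x => W x * η x) :=
  (Lp.memLp W).integrable_mul hη

/-- A weak gradient vanishes outside every closed ball outside which the function vanishes. -/
lemma HasWeakGradient.ae_eq_zero {v : E n → ℝ} {G : E n → E n} (h : HasWeakGradient v G)
    (hG : LocallyIntegrable G) {ρ : ℝ} (hv : ∀ᵐ x, ρ < ‖x‖ → v x = 0) :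
    ∀ᵐ x, ρ < ‖x‖ → G x = 0 := by
  have hU : IsOpen {x : E n | ρ < ‖x‖} := isOpen_lt continuous_const continuous_norm
  refine hU.ae_eq_zero_of_integral_contDiff_smul_eq_zero (hG.locallyIntegrableOn _)
    fun g hg hgc hgs => ?_
  have h1 := h g hg hgc
  rw [integral_eq_zero_of_ae] at h1
  · exact neg_eq_zero.mp h1.symm
  filter_upwards [hv] with x hx
  by_cases hxU : ρ < ‖x‖
  · simp [hx hxU]
  · have : x ∉ tsupport g := fun hxs => hxU (hgs hxs)
    simp [gradient, fderiv_of_notMem_tsupport ℝ this]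

lemma hasGradientAt_exp_inner (ξ x : E n) :
    HasGradientAt (fun y : E n => Real.exp (inner ℝ y ξ)) (Real.exp (inner ℝ x ξ) • ξ) x := by
  rw [hasGradientAt_iff_hasFDerivAt]
  have h1 : HasFDerivAt (fun y : E n => inner ℝ y ξ) (innerSL ℝ ξ) x := by
    simp_rw [real_inner_comm ξ]
    exact (innerSL ℝ ξ).hasFDerivAt
  refine h1.exp.congr_fderiv ?_
  ext y
  simp

/-- Testing a weak gradient with a localized exponential. -/
lemma HasWeakGradient.integral_inner_exp {v : E n → ℝ} {G : E n → E n} (h : HasWeakGradient v G)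
    (hG : MemLp G 2) {ρ : ℝ} (hv : ∀ᵐ x, ρ < ‖x‖ → v x = 0)
    {η : E n → ℝ} (hη : ContDiff ℝ ∞ η) (hηc : HasCompactSupport η) {ξ : E n}
    (hηξ : ∀ x, ‖x‖ < ρ + 1 → η x = Real.exp (inner ℝ x ξ)) (q : ℝ) :
    ∫ x, inner ℝ (G x) (gradient (fun y => q * η y) x) = -(q * (‖ξ‖ ^ 2 * ∫ x, v x * η x)) := by
  -- Both `v` and `G` live on the closed `ρ`-ball, where `∇η = η ξ`; the margin `ρ + 1` makes this
  -- valid up to the boundary. Hence `∫ G · ∇η = ξ · ∫ η G = -ξ · ∫ v ∇η = -‖ξ‖² ∫ v η`.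
  have hG0 := h.ae_eq_zero (hG.locallyIntegrable (by norm_num)) hv
  have hgrad : ∀ x, ‖x‖ ≤ ρ → HasGradientAt η (η x • ξ) x := by
    intro x hx
    have hx' : ‖x‖ < ρ + 1 := by linarith
    rw [hηξ x hx']
    refine (hasGradientAt_exp_inner ξ x).congr_of_eventuallyEq ?_
    filter_upwards [(isOpen_lt continuous_norm continuous_const).mem_nhds hx'] with y hy
    exact hηξ y hy
  have hgradq : ∀ x, ‖x‖ ≤ ρ → gradient (fun y => q * η y) x = (q * η x) • ξ := by
    intro x hx
    have h1 := (hgrad x hx).hasFDerivAt.const_mul q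
    refine HasGradientAt.gradient ?_
    rw [hasGradientAt_iff_hasFDerivAt]
    refine h1.congr_fderiv ?_
    ext y
    simp [mul_assoc]
  have e1 : ∫ x, inner ℝ (G x) (gradient (fun y => q * η y) x)
      = ∫ x, q * inner ℝ ξ (η x • G x) := by
    refine integral_congr_ae ?_
    filter_upwards [hG0] with x hx
    by_cases hxρ : ρ < ‖x‖
    · simp [hx hxρ]
    · rw [hgradq x (not_lt.mp hxρ), real_inner_smul_right, real_inner_smul_right,
        real_inner_comm (G x) ξ]
      ring
  have hint : Integrable (fun x => η x • G x) :=
    (hG.locallyIntegrable (by norm_num)).integrable_smul_left_of_hasCompactSupport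
      hη.continuous hηc
  have e2 : ∫ x, v x • gradient η x = (∫ x, v x * η x) • ξ := by
    rw [← integral_smul_const]
    refine integral_congr_ae ?_
    filter_upwards [hv] with x hx
    by_cases hxρ : ρ < ‖x‖
    · simp [hx hxρ]
    · rw [(hgrad x (not_lt.mp hxρ)).gradient, smul_smul]
  have e3 : ∫ x, η x • G x = -((∫ x, v x * η x) • ξ) := by
    rw [← e2, h η hη hηc, neg_neg]
  rw [e1, integral_const_mul, integral_inner hint, e3, inner_neg_right, real_inner_smul_right,
    real_inner_self_eq_norm_sq]
  ring

end Pairing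

/-! ### Test functions and the reduction to an ordinary differential equation -/

lemma Icc_subset_timeInterval {T : EReal} {X : ℝ} (hX : X ∈ timeInterval T) :
    Icc 0 X ⊆ timeInterval T := fun _ ht =>
  ⟨ht.1, lt_of_le_of_lt (EReal.coe_le_coe_iff.mpr ht.2) hX.2⟩

/-- A smooth time factor equal to the multiplier on a neighbourhood of `[0, X]`. -/
lemma exists_time_cutoff (μ β : ℝ) {T : EReal} {X : ℝ} (hX : X ∈ timeInterval T) :
    ∃ q : ℝ → ℝ, ∃ K : Set ℝ, ContDiff ℝ ∞ q ∧ IsCompact K ∧ Function.support q ⊆ K ∧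
      (∀ s ∈ K, (s : EReal) < T) ∧ ∀ t ∈ Icc 0 X, q =ᶠ[nhds t] multiplier μ β := by
  obtain ⟨r, hXr, hrT⟩ := EReal.lt_iff_exists_real_btwn.mp hX.2
  rw [EReal.coe_lt_coe_iff] at hXr
  have hX0 : 0 ≤ X := hX.1
  -- The bound `r - X` keeps the support below `T`; the bound `1/2` keeps it in `t > -1`, where the
  -- multiplier is smooth.
  set δ : ℝ := min (r - X) (1 / 2) with hδ
  have hδ0 : 0 < δ := lt_min (by linarith) (by norm_num)
  have hδr : δ ≤ r - X := min_le_left _ _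
  have hδ1 : δ ≤ 1 / 2 := min_le_right _ _
  let a : ContDiffBump (X / 2) := ⟨X / 2 + δ / 2, X / 2 + δ, by positivity, by linarith⟩
  have hball : ∀ s ∈ Metric.closedBall (X / 2) (X / 2 + δ), -δ ≤ s ∧ s ≤ X + δ := by
    intro s hs
    rw [Real.closedBall_eq_Icc] at hs
    constructor <;> linarith [hs.1, hs.2]
  have hsupp : Function.support (fun s => a s * multiplier μ β s)
      ⊆ Metric.closedBall (X / 2) (X / 2 + δ) := by
    intro s hs
    have : s ∈ Function.support a := left_ne_zero_of_mul hs
    rw [a.support_eq] at this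
    exact Metric.ball_subset_closedBall this
  refine ⟨fun s => a s * multiplier μ β s, Metric.closedBall (X / 2) (X / 2 + δ), ?_,
    isCompact_closedBall _ _, hsupp, ?_, ?_⟩
  · refine contDiff_iff_contDiffAt.mpr fun s => ?_
    by_cases hs : s ∈ tsupport fun s => a s * multiplier μ β s
    swap
    · exact contDiffAt_const.congr_of_eventuallyEq (notMem_tsupport_iff_eventuallyEq.mp hs)
    have := hball s (closure_minimal hsupp Metric.isClosed_closedBall hs)
    exact a.contDiff.contDiffAt.mul (contDiffAt_multiplier μ β (by linarith))
  · intro s hs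
    refine lt_of_le_of_lt (EReal.coe_le_coe_iff.mpr ?_) hrT
    linarith [(hball s hs).2]
  · intro t ht
    have hmem : t ∈ Metric.ball (X / 2) a.rIn := by
      rw [Real.ball_eq_Ioo]
      constructor <;> simp only [a] <;> linarith [ht.1, ht.2]
    filter_upwards [a.eventuallyEq_one_of_mem_ball hmem] with s hs
    rw [hs]; simp

lemma isTestFunction_mul {n : ℕ} {T : EReal} {q : ℝ → ℝ} {K : Set ℝ} (hq : ContDiff ℝ ∞ q)
    (hK : IsCompact K) (hqK : Function.support q ⊆ K) (hKT : ∀ s ∈ K, (s : EReal) < T)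
    {η : E n → ℝ} (hη : ContDiff ℝ ∞ η) (hηc : HasCompactSupport η) :
    IsTestFunction T (fun z : ℝ × E n => q z.1 * η z.2) := by
  have hsub : Function.support (fun z : ℝ × E n => q z.1 * η z.2) ⊆ K ×ˢ tsupport η := by
    intro z hz
    exact ⟨hqK (left_ne_zero_of_mul hz), subset_tsupport _ (right_ne_zero_of_mul hz)⟩
  have hKc : IsCompact (K ×ˢ tsupport η) := hK.prod hηc
  refine ⟨(hq.comp contDiff_fst).mul (hη.comp contDiff_snd),
    HasCompactSupport.of_support_subset_isCompact hKc hsub, fun z hz => ?_⟩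
  exact hKT _ (closure_minimal hsub hKc.isClosed hz).1

/-- The quantity `∫ u(·, t) exp (x · ξ)` for an energy solution supported in a cone solves an
ordinary differential equation on `[0, X]`. The function `η` is a smooth compactly supported
function equal to `exp (x · ξ)` on the support of `u`. -/
theorem IsEnergySolutionWith.exists_ode {n : ℕ} {p μ β ε R : ℝ} {f g : E n → ℝ} {T : EReal}
    {u : ℝ → E n → ℝ} {U : ℝ → Lp ℝ 2 (volume : Measure (E n))}
    {G : ℝ → Lp (E n) 2 (volume : Measure (E n))} {V : ℝ → Lp ℝ 2 (volume : Measure (E n))}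
    (sol : IsEnergySolutionWith p μ β ε f g T u U G V) (cone : SupportedInCone R T u)
    (hβ : 1 < β) (hR : 0 ≤ R) {X : ℝ} (hX : X ∈ timeInterval T) (ξ : E n) :
    ∃ η : E n → ℝ, ContDiff ℝ ∞ η ∧ HasCompactSupport η ∧ (∀ x, 0 ≤ η x) ∧
      (∀ x, ‖x‖ ≤ X + R → η x = Real.exp (inner ℝ x ξ)) ∧
      (∀ t ∈ Icc 0 X, HasDerivWithinAt (fun s => ∫ x, U s x * η x) (∫ x, V t x * η x)
        (Icc 0 X) t) ∧
      (∀ᵐ s ∂(volume.restrict (Ioo 0 X)), Integrable (fun x => |u s x| ^ p * η x)) ∧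
      IntegrableOn (fun s => multiplier μ β s * ∫ x, |u s x| ^ p * η x) (Ioo 0 X) ∧
      ∀ t ∈ Icc 0 X, multiplier μ β t * (∫ x, V t x * η x)
          = multiplier μ β 0 * (∫ x, V 0 x * η x)
          + ‖ξ‖ ^ 2 * (∫ s in (0 : ℝ)..t, multiplier μ β s * ∫ x, U s x * η x)
          + ∫ s in (0 : ℝ)..t, multiplier μ β s * ∫ x, |u s x| ^ p * η x := by
  have hX0 : 0 ≤ X := hX.1
  have hsub := Icc_subset_timeInterval hX
  obtain ⟨q, K, hq, hK, hqK, hKT, hqm⟩ := exists_time_cutoff μ β hX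
  let b : ContDiffBump (0 : E n) := ⟨X + R + 1, X + R + 2, by positivity, by linarith⟩
  set η : E n → ℝ := fun x => b x * Real.exp (inner ℝ x ξ) with hη
  have hηs : ContDiff ℝ ∞ η :=
    b.contDiff.mul ((contDiff_id.inner ℝ contDiff_const).exp)
  have hηc : HasCompactSupport η := b.hasCompactSupport.mul_right
  have hη1 : ∀ x, ‖x‖ < X + R + 1 → η x = Real.exp (inner ℝ x ξ) := by
    intro x hx
    rw [hη]
    simp only
    rw [b.one_of_mem_closedBall (by simpa [b] using hx.le), one_mul]
  have hη2 : MemLp η 2 := hηs.continuous.memLp_of_hasCompactSupport hηc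
  have hφ := isTestFunction_mul hq hK hqK hKT hηs hηc
  have hqe : ∀ t ∈ Icc 0 X, q t = multiplier μ β t := fun t ht => (hqm t ht).self_of_nhds
  have hqd : ∀ t ∈ Icc 0 X, deriv q t = μ / (1 + t) ^ β * multiplier μ β t := fun t ht => by
    rw [(hqm t ht).deriv_eq, (hasDerivAt_multiplier μ hβ (by linarith [ht.1])).deriv]
  have hU0 : ∀ t ∈ Icc 0 X, ∀ᵐ x, X + R < ‖x‖ → U t x = 0 := by
    intro t ht
    filter_upwards [cone t (hsub ht), sol.ae_eq t (hsub ht)] with x hx hxu hxR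
    rw [← hxu]
    exact hx (by linarith [ht.2])
  have hint := sol.integrable_nonlinearity _ hφ X hX
  have hprod : (volume : Measure (ℝ × E n)).restrict (Ioo 0 X ×ˢ univ)
      = (volume.restrict (Ioo 0 X)).prod volume := by
    rw [Measure.volume_eq_prod, ← Measure.prod_restrict, Measure.restrict_univ]
  -- Integrability is known only on space-time, so Fubini gives it on almost every time slice.
  rw [IntegrableOn, hprod] at hint
  have hIoo : ∀ᵐ s ∂(volume.restrict (Ioo 0 X)), s ∈ Ioo 0 X :=
    ae_restrict_mem measurableSet_Ioo
  refine ⟨η, hηs, hηc, fun x => mul_nonneg b.nonneg (Real.exp_pos _).le,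
    fun x hx => hη1 x (by linarith), ?_, ?_, ?_, ?_⟩
  · exact fun t ht => hasDerivWithinAt_pairing hη2 ((sol.hasDeriv t (hsub ht)).mono hsub)
  · filter_upwards [hint.prod_right_ae, hIoo] with s hs hsI
    have h0 := multiplier_pos μ β s
    have h1 := hs.const_mul (multiplier μ β s)⁻¹
    refine h1.congr (.of_forall fun x => ?_)
    simp only
    rw [hqe s (Ioo_subset_Icc_self hsI)]
    field_simp
  · refine hint.integral_prod_left.congr ?_
    filter_upwards [hIoo] with s hsI
    rw [← hqe s (Ioo_subset_Icc_self hsI), ← integral_const_mul]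
    refine integral_congr_ae (.of_forall fun x => ?_)
    simp only
    ring
  · intro t ht
    have hst : ∀ s ∈ uIcc 0 t, s ∈ Icc 0 X := by
      rw [uIcc_of_le ht.1]
      exact fun s hs => ⟨hs.1, hs.2.trans ht.2⟩
    have hwf := sol.weak_formulation _ hφ t (hsub ht)
    have hvc : ContinuousOn (fun s => ∫ x, V s x * η x) (Icc 0 X) :=
      continuousOn_pairing hη2 (sol.continuousOn_V.mono hsub)
    have hhc : ContinuousOn (fun s => ∫ x, U s x * η x) (Icc 0 X) :=
      continuousOn_pairing hη2 (sol.continuousOn_U.mono hsub)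
    have hmc : ContinuousOn (multiplier μ β) (Icc 0 X) := fun s hs =>
      (hasDerivAt_multiplier μ hβ (by linarith [hs.1])).continuousAt.continuousWithinAt
    have hbc : ContinuousOn (fun s : ℝ => μ / (1 + s) ^ β) (Icc 0 X) := by
      refine continuousOn_const.div (ContinuousOn.rpow_const (by fun_prop) fun s hs => ?_) ?_
      · exact Or.inr (by linarith)
      · intro s hs
        have : (0 : ℝ) < 1 + s := by linarith [hs.1]
        positivity
    have e1 : ∀ s ∈ Icc 0 X, ∫ x, V s x * (q s * η x)
        = multiplier μ β s * ∫ x, V s x * η x := by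
      intro s hs
      rw [hqe s hs, ← integral_const_mul]
      exact integral_congr_ae (.of_forall fun x => by simp only; ring)
    -- The first term, coming from the derivative of the multiplier, cancels the damping integral
    -- `e3` exactly.
    have e2 : ∀ s ∈ Icc 0 X, ∫ x, (-(V s x * deriv (fun r => q r * η x) s)
          + inner ℝ (G s x) (gradient (fun y => q s * η y) x))
        = -(μ / (1 + s) ^ β * multiplier μ β s * ∫ x, V s x * η x)
          - ‖ξ‖ ^ 2 * (multiplier μ β s * ∫ x, U s x * η x) := by
      intro s hs
      have hd : ∀ x, deriv (fun r => q r * η x) s = deriv q s * η x := fun x =>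
        deriv_mul_const ((hq.differentiable (by norm_num)) s) _
      have hg := (sol.weakGradient s (hsub hs)).integral_inner_exp (Lp.memLp (G s)) (hU0 s hs)
        hηs hηc hη1 (q s)
      rw [integral_add, hg, integral_neg]
      · simp only [hd, hqd s hs]
        have e : ∫ x, V s x * (μ / (1 + s) ^ β * multiplier μ β s * η x)
            = μ / (1 + s) ^ β * multiplier μ β s * ∫ x, V s x * η x := by
          rw [← integral_const_mul]
          exact integral_congr_ae (.of_forall fun x => by ring)
        rw [hqe s hs, e]
        ring
      · refine (((integrable_pairing hη2 (V s)).const_mul (deriv q s)).neg).congr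
          (.of_forall fun x => ?_)
        simp only [hd, Pi.neg_apply]
        ring
      · have hgc : HasCompactSupport (fun x => gradient (fun y => q s * η y) x) := by
          have : HasCompactSupport (fun y => q s * η y) := hηc.mul_left
          exact (this.fderiv (𝕜 := ℝ)).comp_left (map_zero _)
        have hgcont : Continuous (fun x => gradient (fun y => q s * η y) x) :=
          (InnerProductSpace.toDual ℝ (E n)).symm.continuous.comp
            ((contDiff_const.mul hηs).continuous_fderiv (by norm_num))
        have hgm := hgcont.memLp_of_hasCompactSupport (p := 2) (μ := volume) hgc
        refine (L2.integrable_inner (𝕜 := ℝ) (G s) (hgm.toLp _)).congr ?_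
        filter_upwards [hgm.coeFn_toLp] with x hx
        rw [hx]
    have e3 : ∀ s, s ∈ Icc 0 X → ∫ x, μ * V s x / (1 + s) ^ β * (q s * η x)
        = μ / (1 + s) ^ β * multiplier μ β s * ∫ x, V s x * η x := by
      intro s hs
      rw [hqe s hs, ← integral_const_mul]
      exact integral_congr_ae (.of_forall fun x => by simp only; ring)
    have e4 : ∀ s, s ∈ Icc 0 X → ∫ x, |u s x| ^ p * (q s * η x)
        = multiplier μ β s * ∫ x, |u s x| ^ p * η x := by
      intro s hs
      rw [hqe s hs, ← integral_const_mul]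
      exact integral_congr_ae (.of_forall fun x => by simp only; ring)
    simp only at hwf
    rw [e1 t ht, e1 0 ⟨le_rfl, hX0⟩,
      intervalIntegral.integral_congr (fun s hs => e2 s (hst s hs)),
      intervalIntegral.integral_congr (fun s hs => e3 s (hst s hs)),
      intervalIntegral.integral_congr (fun s hs => e4 s (hst s hs)),
      intervalIntegral.integral_sub, intervalIntegral.integral_neg,
      intervalIntegral.integral_const_mul] at hwf
    · linarith
    · refine ContinuousOn.intervalIntegrable ?_
      exact (((hbc.mul hmc).mul hvc).neg).mono hst
    · refine ContinuousOn.intervalIntegrable ?_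
      exact (continuousOn_const.mul (hmc.mul hhc)).mono hst

/-! ### The Strauss polynomial and lower bounds as powers of time -/

/-- With `D` the square root in `p_S`, `4 (n - 1) γ = D² - (2 (n - 1) p - (n + 1))²`. One factor is
positive by `p < p_S`, the other by `D ≥ n + 1`. For `n = 1`, `γ = 2 + 2 p`. -/
lemma straussGamma_pos {n : ℕ} (hn : 1 ≤ n) {p : ℝ} (hp : 1 < p)
    (hpS : 2 ≤ n → p < straussExponent n) : 0 < straussGamma p n := by
  rcases Nat.lt_or_ge n 2 with h | h
  · obtain rfl : n = 1 := by omega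
    simp only [straussGamma, Nat.cast_one]
    linarith
  · have hn' : (2 : ℝ) ≤ n := by exact_mod_cast h
    have h1 := hpS h
    rw [straussExponent, lt_div_iff₀ (by linarith)] at h1
    have hD : √((n : ℝ) ^ 2 + 10 * n - 7) ^ 2 = (n : ℝ) ^ 2 + 10 * n - 7 :=
      Real.sq_sqrt (by nlinarith)
    set D := √((n : ℝ) ^ 2 + 10 * n - 7)
    have hD0 : 0 ≤ D := Real.sqrt_nonneg _
    have hDn : (n : ℝ) + 1 ≤ D := abs_le_of_sq_le_sq' (by nlinarith) hD0 |>.2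
    have h2 : 0 < 2 * ((n : ℝ) - 1) * p := by
      have : 0 < (n : ℝ) - 1 := by linarith
      positivity
    have h3 : 0 < (D - (2 * ((n : ℝ) - 1) * p - (n + 1))) * (D + (2 * ((n : ℝ) - 1) * p - (n + 1))) :=
      mul_pos (by linarith) (by linarith)
    have h4 : 0 < 4 * ((n : ℝ) - 1) * straussGamma p n := by
      rw [straussGamma]
      nlinarith
    exact (mul_pos_iff_of_pos_left (by linarith)).mp h4

/-- The lower bound for the `L^p` norm in `lintegral_rpow_lower_bound`, as a power of time. -/
lemma exists_rpow_lower_bound (k : ℕ) {p R : ℝ} (hp : 1 < p) (hR : 0 < R) :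
    ∃ c₁ : ℝ, 0 < c₁ ∧ ∀ t : ℝ, 1 / 2 ≤ t → ∀ w : E (k + 1) → ℝ≥0∞, AEMeasurable w →
      (∀ᵐ x, t + R < ‖x‖ → w x = 0) → ∀ c : ℝ, 0 < c →
      (∀ ξ : E (k + 1), 1 ≤ ‖ξ‖ → ‖ξ‖ ≤ 2 →
        ENNReal.ofReal c ≤ ∫⁻ x, w x * ENNReal.ofReal (Real.exp (inner ℝ x ξ - ‖ξ‖ * t))) →
      ENNReal.ofReal (c₁ * c ^ p * t ^ (k * (1 - p / 2))) ≤ ∫⁻ x, w x ^ p := by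
  set A := {ξ : E (k + 1) | 1 ≤ ‖ξ‖ ∧ ‖ξ‖ ≤ 2} with hA
  have hAtop : volume A ≠ ⊤ := by
    refine ne_top_of_le_ne_top (Metric.isBounded_closedBall (x := (0 : E (k + 1)))
      (r := 2)).measure_lt_top.ne (measure_mono fun ξ hξ => ?_)
    simpa using hξ.2
  have hApos : 0 < volume A := by
    obtain ⟨e, he⟩ := exists_norm_eq (E (k + 1)) (by norm_num : (0 : ℝ) ≤ 3 / 2)
    have hopen : IsOpen {ξ : E (k + 1) | 1 < ‖ξ‖ ∧ ‖ξ‖ < 2} :=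
      (isOpen_lt continuous_const continuous_norm).inter
        (isOpen_lt continuous_norm continuous_const)
    refine (hopen.measure_pos volume ⟨e, ?_⟩).trans_le
      (measure_mono fun ξ hξ => ⟨hξ.1.le, hξ.2.le⟩)
    simp only [mem_ofPred_eq, he]
    norm_num
  set v := (volume A).toReal with hv
  have hv0 : 0 < v := ENNReal.toReal_pos hApos.ne' hAtop
  set b : ℝ := Real.exp (2 * R) * (4 * √(4 * Real.pi) ^ k) with hb
  set a : ℝ := Real.exp (2 * R) * (2 * √(4 * Real.pi * (1 + 2 * R)) ^ k) with ha
  have hpi := Real.pi_pos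
  have ha0 : 0 < a := by positivity
  have hb0 : 0 < b := by positivity
  refine ⟨v / (b * a ^ (p - 1)), by positivity, fun t ht w hw hwR c hc hcξ => ?_⟩
  have ht0 : 0 < t := by linarith
  have key := lintegral_rpow_lower_bound hp ht0 hR hw hwR hcξ
  have hCB : Real.exp (2 * R) * (4 * √(Real.pi / (t / 4)) ^ k) = b * t ^ (-(k / 2 : ℝ)) := by
    have e1 : √(Real.pi / (t / 4)) = √(4 * Real.pi) * t ^ (-(1 / 2) : ℝ) := by
      rw [show Real.pi / (t / 4) = 4 * Real.pi * t⁻¹ by field_simp,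
        Real.sqrt_mul (by positivity), Real.sqrt_eq_rpow t⁻¹, Real.inv_rpow ht0.le,
        Real.rpow_neg ht0.le]
    rw [e1, mul_pow, ← Real.rpow_natCast (t ^ _), ← Real.rpow_mul ht0.le, hb,
      show -(1 / 2 : ℝ) * k = -(k / 2) by ring]
    ring
  -- Here `t ≥ 1/2` is needed: it gives `t + R ≤ (1 + 2 R) t`.
  have hCA : Real.exp (2 * R) * (2 * √(Real.pi / (1 / (4 * (t + R)))) ^ k)
      ≤ a * t ^ (k / 2 : ℝ) := by
    have e1 : √(Real.pi / (1 / (4 * (t + R)))) ≤ √(4 * Real.pi * (1 + 2 * R)) * t ^ (1 / 2 : ℝ) := by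
      rw [← Real.sqrt_eq_rpow, ← Real.sqrt_mul (by positivity)]
      apply Real.sqrt_le_sqrt
      have : t + R ≤ (1 + 2 * R) * t := by nlinarith
      calc Real.pi / (1 / (4 * (t + R))) = 4 * Real.pi * (t + R) := by field_simp
        _ ≤ 4 * Real.pi * ((1 + 2 * R) * t) := by gcongr
        _ = _ := by ring
    have e2 : (t ^ (1 / 2 : ℝ)) ^ k = t ^ (k / 2 : ℝ) := by
      rw [← Real.rpow_natCast, ← Real.rpow_mul ht0.le]
      congr 1; ring
    calc _ ≤ Real.exp (2 * R) * (2 * (√(4 * Real.pi * (1 + 2 * R)) * t ^ (1 / 2 : ℝ)) ^ k) := by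
          gcongr
      _ = _ := by rw [mul_pow, e2, ha]; ring
  rw [hCB] at key
  set J := ∫⁻ x, w x ^ p with hJ
  have key2 : ENNReal.ofReal (c ^ p * v) ≤ J * ENNReal.ofReal (b * t ^ (-(k / 2 : ℝ))
      * (a * t ^ (k / 2 : ℝ)) ^ (p - 1)) := by
    rw [ENNReal.ofReal_mul (by positivity), ENNReal.ofReal_mul (by positivity), hv,
      ENNReal.ofReal_toReal hAtop, ← ENNReal.ofReal_rpow_of_pos hc,
      ← ENNReal.ofReal_rpow_of_pos (by positivity), ← mul_assoc]
    refine key.trans ?_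
    gcongr
  have hpos : 0 < b * t ^ (-(k / 2 : ℝ)) * (a * t ^ (k / 2 : ℝ)) ^ (p - 1) := by positivity
  rw [← ENNReal.div_le_iff_le_mul (Or.inl (by simpa using hpos)) (Or.inl ENNReal.ofReal_ne_top),
    ← ENNReal.ofReal_div_of_pos hpos] at key2
  refine le_trans (le_of_eq ?_) key2
  congr 1
  have e3 : t ^ ((k : ℝ) * (1 - p / 2)) = (t ^ (-(k / 2 : ℝ)) * (t ^ (k / 2 : ℝ)) ^ (p - 1))⁻¹ := by
    rw [← Real.rpow_mul ht0.le, ← Real.rpow_add ht0, ← Real.rpow_neg ht0.le]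
    congr 1; ring
  rw [e3, Real.mul_rpow ha0.le (by positivity)]
  field_simp

/-- Hölder's inequality on a ball. -/
lemma exists_rpow_lower_bound_of_integral (n : ℕ) {p : ℝ} (hp : 1 < p) :
    ∃ c₂ : ℝ, 0 < c₂ ∧ ∀ ρ : ℝ, 0 < ρ → ∀ w : E n → ℝ≥0∞, AEMeasurable w →
      (∀ᵐ x, ρ < ‖x‖ → w x = 0) → ∀ M : ℝ, 0 < M → ENNReal.ofReal M ≤ ∫⁻ x, w x →
      ENNReal.ofReal (c₂ * M ^ p * ρ ^ (-(n * (p - 1)))) ≤ ∫⁻ x, w x ^ p := by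
  set v := (volume (Metric.ball (0 : E n) 1)).toReal with hv
  have hvtop : volume (Metric.ball (0 : E n) 1) ≠ ⊤ := Metric.isBounded_ball.measure_lt_top.ne
  have hv0 : 0 < v := ENNReal.toReal_pos (Metric.measure_ball_pos _ _ one_pos).ne' hvtop
  refine ⟨(v ^ (p - 1))⁻¹, by positivity, fun ρ hρ w hw hwρ M hM hMw => ?_⟩
  set S := Metric.closedBall (0 : E n) ρ
  have hS : MeasurableSet S := Metric.isClosed_closedBall.measurableSet
  have hr : ∫⁻ x, w x = ∫⁻ x in S, w x := by
    rw [← lintegral_indicator hS]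
    refine lintegral_congr_ae ?_
    filter_upwards [hwρ] with x hx
    by_cases hxS : x ∈ S
    · rw [indicator_of_mem hxS]
    · rw [indicator_of_notMem hxS]
      exact hx (by simpa [S] using hxS)
  have h1 := lintegral_rpow_le (volume.restrict S) hp hw.restrict
  rw [← hr, Measure.restrict_apply_univ, Measure.addHaar_closedBall _ _ hρ.le,
    finrank_euclideanSpace_fin, ← ENNReal.ofReal_toReal hvtop, ← hv,
    ← ENNReal.ofReal_mul (by positivity), ENNReal.ofReal_rpow_of_pos (by positivity)] at h1
  have h2 : ENNReal.ofReal (M ^ p) ≤ (∫⁻ x, w x ^ p) * ENNReal.ofReal ((ρ ^ n * v) ^ (p - 1)) := by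
    rw [← ENNReal.ofReal_rpow_of_pos hM]
    refine (ENNReal.rpow_le_rpow hMw (by linarith)).trans (h1.trans ?_)
    gcongr
    exact Measure.restrict_le_self
  have hpos : 0 < (ρ ^ n * v) ^ (p - 1) := by positivity
  rw [← ENNReal.div_le_iff_le_mul (Or.inl (by simpa using hpos)) (Or.inl ENNReal.ofReal_ne_top),
    ← ENNReal.ofReal_div_of_pos hpos] at h2
  refine le_trans (le_of_eq ?_) h2
  congr 1
  rw [Real.mul_rpow (by positivity) hv0.le, ← Real.rpow_natCast, ← Real.rpow_mul hρ.le,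
    Real.rpow_neg hρ.le]
  field_simp

/-! ### Growth of averages of energy solutions -/

/-- A lower bound for the right-hand side of `(m F')' = m N` makes `F` grow quadratically. -/
lemma growth_of_ode {F v m N : ℝ → ℝ} {X : ℝ}
    (hd : ∀ t ∈ Icc 0 X, HasDerivWithinAt F (v t) (Icc 0 X) t)
    (hm0 : ∀ t ∈ Icc 0 X, 0 < m t) (hm1 : ∀ t ∈ Icc 0 X, m t ≤ 1)
    (hmm : ∀ t ∈ Icc 0 X, m 0 ≤ m t) (hN : IntegrableOn (fun s => m s * N s) (Ioo 0 X))
    (hN0 : ∀ s, 0 ≤ N s) (hv0 : 0 ≤ v 0)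
    (hmv : ∀ t ∈ Icc 0 X, m t * v t = m 0 * v 0 + ∫ s in (0 : ℝ)..t, m s * N s)
    {s t ν : ℝ} (hs : 0 ≤ s) (hst : s ≤ t) (htX : t ≤ X) (hν : 0 ≤ ν)
    (hNν : ∀ᵐ r ∂(volume.restrict (Ioo s t)), ν ≤ N r) :
    F s + m 0 * ν * (t - s) ^ 2 / 2 ≤ F t := by
  have hX : 0 ≤ X := hs.trans (hst.trans htX)
  have h0X : (0 : ℝ) ∈ Icc 0 X := ⟨le_rfl, hX⟩
  have hii : ∀ a c, 0 ≤ a → a ≤ c → c ≤ X →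
      IntervalIntegrable (fun s => m s * N s) volume a c := by
    intro a c ha hac hc
    rw [intervalIntegrable_iff_integrableOn_Ioo_of_le hac]
    exact hN.mono_set (Ioo_subset_Ioo ha hc)
  -- First integration: the initial velocity and the contribution of `[0, s]` are nonnegative and
  -- dropped, and `m ≤ 1` removes the weight on the left.
  have hvr : ∀ r ∈ Icc s t, m 0 * ν * (r - s) ≤ v r := by
    intro r hr
    have hrX : r ∈ Icc 0 X := ⟨hs.trans hr.1, hr.2.trans htX⟩
    have h1 : 0 ≤ ∫ x in (0 : ℝ)..s, m x * N x :=
      intervalIntegral.integral_nonneg hs fun x hx =>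
        mul_nonneg (hm0 x ⟨hx.1, hx.2.trans (hr.1.trans hrX.2)⟩).le (hN0 x)
    have h2 : m 0 * ν * (r - s) ≤ ∫ x in s..r, m x * N x := by
      have : ∫ x in s..r, m 0 * ν = m 0 * ν * (r - s) := by
        rw [intervalIntegral.integral_const, smul_eq_mul]; ring
      rw [← this, intervalIntegral.integral_of_le hr.1, intervalIntegral.integral_of_le hr.1,
        integral_Ioc_eq_integral_Ioo, integral_Ioc_eq_integral_Ioo]
      refine setIntegral_mono_ae_restrict
        (integrableOn_const (by simp) : IntegrableOn (fun _ => m 0 * ν) (Ioo s r) volume)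
        (hN.mono_set (Ioo_subset_Ioo hs hrX.2)) ?_
      filter_upwards [ae_restrict_of_ae_restrict_of_subset (Ioo_subset_Ioo_right hr.2) hNν,
        ae_restrict_mem measurableSet_Ioo] with x hx hxI
      have hxX : x ∈ Icc 0 X := ⟨hs.trans hxI.1.le, hxI.2.le.trans hrX.2⟩
      exact mul_le_mul (hmm x hxX) hx hν (hm0 x hxX).le
    have h3 : m 0 * ν * (r - s) ≤ m r * v r := by
      rw [hmv r hrX, ← intervalIntegral.integral_add_adjacent_intervals
        (hii 0 s le_rfl hs (hr.1.trans hrX.2)) (hii s r hs hr.1 hrX.2)]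
      have := mul_nonneg (hm0 0 h0X).le hv0
      linarith
    have h4 : 0 ≤ m 0 * ν * (r - s) :=
      mul_nonneg (mul_nonneg (hm0 0 h0X).le hν) (by linarith [hr.1])
    have h5 : 0 ≤ v r := nonneg_of_mul_nonneg_right (h4.trans h3) (hm0 r hrX)
    nlinarith [hm1 r hrX]
  have hsub : Icc s t ⊆ Icc 0 X := Icc_subset_Icc hs htX
  have hc : ContinuousOn F (Icc 0 X) := fun t ht => (hd t ht).continuousWithinAt
  have hder : ∀ r ∈ Ioo s t, HasDerivAt (fun r => F r - m 0 * ν * (r - s) ^ 2 / 2)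
      (v r - m 0 * ν * (r - s)) r := by
    intro r hr
    have h1 : HasDerivAt F (v r) r := (hd r (hsub (Ioo_subset_Icc_self hr))).hasDerivAt
      (Icc_mem_nhds (hs.trans_lt hr.1) (hr.2.trans_le htX))
    have h2 := h1.sub (((((hasDerivAt_id r).sub_const s).pow 2).const_mul (m 0 * ν)).div_const 2)
    refine h2.congr_deriv ?_
    simp
    ring
  have hmono : MonotoneOn (fun r => F r - m 0 * ν * (r - s) ^ 2 / 2) (Icc s t) := by
    apply monotoneOn_of_deriv_nonneg (convex_Icc s t)
    · exact (hc.mono hsub).sub (by fun_prop)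
    · rw [interior_Icc]
      exact fun r hr => (hder r hr).differentiableAt.differentiableWithinAt
    · rw [interior_Icc]
      intro r hr
      rw [(hder r hr).deriv]
      linarith [hvr r (Ioo_subset_Icc_self hr)]
  have h1 := hmono ⟨le_rfl, hst⟩ ⟨hst, le_rfl⟩ hst
  simp only [sub_self] at h1
  norm_num at h1
  linarith

section Data

variable {n : ℕ} {p μ β ε R : ℝ} {f g : E n → ℝ} {T : EReal} {u : ℝ → E n → ℝ}
  {U : ℝ → Lp ℝ 2 (volume : Measure (E n))} {G : ℝ → Lp (E n) 2 (volume : Measure (E n))}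
  {V : ℝ → Lp ℝ 2 (volume : Measure (E n))}

lemma zero_mem_timeInterval (hT : 0 < T) : (0 : ℝ) ∈ timeInterval T := ⟨le_rfl, by simpa using hT⟩

lemma IsEnergySolutionWith.data_ae_eq_zero (sol : IsEnergySolutionWith p μ β ε f g T u U G V)
    (cone : SupportedInCone R T u) (hT : 0 < T) (hε : 0 < ε) :
    ∀ᵐ x, R < ‖x‖ → f x = 0 := by
  filter_upwards [cone 0 (zero_mem_timeInterval hT), sol.initial_position] with x hx hu hxR
  rw [zero_add] at hx
  rw [hx hxR] at hu
  exact (mul_eq_zero.mp hu.symm).resolve_left hε.ne'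

/-- Averages of energy solutions against plane waves stay bounded below. -/
lemma IsEnergySolutionWith.planeWave_lower_bound
    (sol : IsEnergySolutionWith p μ β ε f g T u U G V) (cone : SupportedInCone R T u)
    (hT : 0 < T) (hε : 0 < ε) (hμ : 0 < μ) (hβ : 1 < β) (hR : 0 < R)
    (hf0 : ∀ᵐ x, 0 ≤ f x) (hg0 : ∀ᵐ x, 0 ≤ g x) (hfi : Integrable f) (hfpos : 0 < ∫ x, f x)
    {t : ℝ} (ht : t ∈ timeInterval T) {ξ : E n} (hξ : ‖ξ‖ ≤ 2) :
    ENNReal.ofReal (multiplier μ β 0 / 2 * (ε * (Real.exp (-(2 * R)) * ∫ x, f x)))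
      ≤ ∫⁻ x, ‖u t x‖ₑ * ENNReal.ofReal (Real.exp (inner ℝ x ξ - ‖ξ‖ * t)) := by
  obtain ⟨η, hηs, hηc, hη0, hη, hd, -, -, hode⟩ := sol.exists_ode cone hβ hR.le ht ξ
  have hfz := sol.data_ae_eq_zero cone hT hε
  have ht0 : 0 ≤ t := ht.1
  have h0t : (0 : ℝ) ∈ Icc 0 t := ⟨le_rfl, ht0⟩
  have hη2 : MemLp η 2 := hηs.continuous.memLp_of_hasCompactSupport hηc
  have hU0 : U 0 =ᵐ[volume] fun x => ε * f x :=
    (sol.ae_eq 0 (zero_mem_timeInterval hT)).symm.trans sol.initial_position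
  have h0 : ε * (Real.exp (-(2 * R)) * ∫ x, f x) ≤ ∫ x, U 0 x * η x := by
    rw [← integral_const_mul, ← integral_const_mul]
    refine integral_mono_ae ((hfi.const_mul _).const_mul _) (integrable_pairing hη2 _) ?_
    filter_upwards [hU0, hf0, hfz] with x hx hfx hxz
    rw [hx, mul_assoc]
    refine mul_le_mul_of_nonneg_left ?_ hε.le
    rw [mul_comm (f x)]
    by_cases hxR : R < ‖x‖
    · simp [hxz hxR]
    refine mul_le_mul_of_nonneg_right ?_ hfx
    rw [hη x (by linarith)]
    apply Real.exp_le_exp.mpr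
    have h1 := abs_le.mp (abs_real_inner_le_norm x ξ)
    have h2 : ‖x‖ * ‖ξ‖ ≤ R * 2 :=
      mul_le_mul (not_lt.mp hxR) hξ (norm_nonneg _) hR.le
    linarith [h1.1]
  have hc0 : 0 < ε * (Real.exp (-(2 * R)) * ∫ x, f x) := by positivity
  have hv0 : 0 ≤ ∫ x, V 0 x * η x := by
    refine integral_nonneg_of_ae ?_
    filter_upwards [sol.initial_velocity, hg0] with x hx hgx
    rw [hx]
    exact mul_nonneg (mul_nonneg hε.le hgx) (hη0 x)
  -- Dropping the initial velocity and the nonlinearity, both nonnegative, leaves the linear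
  -- inequality with `l = ‖ξ‖`; the growth `exp (‖ξ‖ t)` offsets the decay of the plane wave.
  have hlow := exp_lower_bound (norm_nonneg ξ) (hc0.trans_le h0) hd
    (m := multiplier μ β) (m' := fun s => μ / (1 + s) ^ β * multiplier μ β s)
    (fun s hs => hasDerivAt_multiplier μ hβ (by linarith [hs.1]))
    (fun s hs => mul_nonneg (div_nonneg hμ.le (Real.rpow_nonneg (by linarith [hs.1]) _))
      (multiplier_pos _ _ _).le)
    (fun s _ => multiplier_pos μ β s) (fun s hs => multiplier_le_one hμ hβ hs.1)
    (by
      intro s hs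
      rw [hode s hs]
      have h1 : 0 ≤ ∫ r in (0 : ℝ)..s, multiplier μ β r * ∫ x, |u r x| ^ p * η x :=
        intervalIntegral.integral_nonneg hs.1 fun r _ => mul_nonneg (multiplier_pos _ _ _).le
          (integral_nonneg fun x => mul_nonneg (Real.rpow_nonneg (abs_nonneg _) _) (hη0 x))
      have h2 := mul_nonneg (multiplier_pos μ β 0).le hv0
      linarith)
    t ⟨ht0, le_rfl⟩
  have hm0 := multiplier_pos μ β 0
  have h1 : multiplier μ β 0 / 2 * (ε * (Real.exp (-(2 * R)) * ∫ x, f x))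
      ≤ ∫ x, U t x * η x * Real.exp (-(‖ξ‖ * t)) := by
    rw [integral_mul_const, Real.exp_neg (‖ξ‖ * t), ← div_eq_mul_inv, le_div_iff₀ (Real.exp_pos _)]
    refine le_trans ?_ hlow
    gcongr
  calc _ ≤ ENNReal.ofReal (∫ x, U t x * η x * Real.exp (-(‖ξ‖ * t))) :=
        ENNReal.ofReal_le_ofReal h1
    _ ≤ ‖∫ x, U t x * η x * Real.exp (-(‖ξ‖ * t))‖ₑ := Real.ofReal_le_enorm _
    _ ≤ ∫⁻ x, ‖U t x * η x * Real.exp (-(‖ξ‖ * t))‖ₑ := enorm_integral_le_lintegral_enorm _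
    _ = _ := by
      refine lintegral_congr_ae ?_
      filter_upwards [sol.ae_eq t ht, cone t ht] with x hx hxc
      rw [← hx]
      by_cases hxR : t + R < ‖x‖
      · simp [hxc hxR]
      · rw [hη x (not_lt.mp hxR), mul_assoc, ← Real.exp_add, enorm_mul,
          Real.enorm_of_nonneg (Real.exp_pos _).le, sub_eq_add_neg]

end Data

/-- The integral `∫ u(·, t)` of an energy solution supported in a cone grows quadratically as long
as the right-hand side is bounded below. -/
lemma IsEnergySolutionWith.exists_growth {n : ℕ} {p μ β ε R : ℝ} {f g : E n → ℝ} {T : EReal}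
    {u : ℝ → E n → ℝ} {U : ℝ → Lp ℝ 2 (volume : Measure (E n))}
    {G : ℝ → Lp (E n) 2 (volume : Measure (E n))} {V : ℝ → Lp ℝ 2 (volume : Measure (E n))}
    (sol : IsEnergySolutionWith p μ β ε f g T u U G V) (cone : SupportedInCone R T u)
    (hT : 0 < T) (hε : 0 < ε) (hμ : 0 < μ) (hβ : 1 < β) (hR : 0 < R) (hp : 1 < p)
    (hf0 : ∀ᵐ x, 0 ≤ f x) (hg0 : ∀ᵐ x, 0 ≤ g x) {X : ℝ} (hX : X ∈ timeInterval T) :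
    ∃ F : ℝ → ℝ, 0 ≤ F 0 ∧ (∀ t ∈ Icc 0 X, ENNReal.ofReal (F t) ≤ ∫⁻ x, ‖u t x‖ₑ) ∧
      ∀ s t ν : ℝ, 0 ≤ s → s ≤ t → t ≤ X → 0 ≤ ν →
        (∀ r ∈ Ioo s t, ENNReal.ofReal ν ≤ ∫⁻ x, ‖u r x‖ₑ ^ p) →
        F s + multiplier μ β 0 * ν * (t - s) ^ 2 / 2 ≤ F t := by
  -- Frequency `ξ = 0`: `η` is `1` on the support of `u` up to time `X`, and the term with `‖ξ‖²`
  -- disappears.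
  obtain ⟨η, hηs, hηc, hη0, hη, hd, hNae, hNi, hode⟩ := sol.exists_ode cone hβ hR.le hX 0
  have hsub := Icc_subset_timeInterval hX
  have hη1 : ∀ x, ‖x‖ ≤ X + R → η x = 1 := fun x hx => by rw [hη x hx]; simp
  have hU0 : U 0 =ᵐ[volume] fun x => ε * f x :=
    (sol.ae_eq 0 (zero_mem_timeInterval hT)).symm.trans sol.initial_position
  refine ⟨fun t => ∫ x, U t x * η x, ?_, ?_, ?_⟩
  · refine integral_nonneg_of_ae ?_
    filter_upwards [hU0, hf0] with x hx hfx
    rw [hx]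
    exact mul_nonneg (mul_nonneg hε.le hfx) (hη0 x)
  · intro t ht
    refine (Real.ofReal_le_enorm _).trans ((enorm_integral_le_lintegral_enorm _).trans
      (le_of_eq ?_))
    refine lintegral_congr_ae ?_
    filter_upwards [sol.ae_eq t (hsub ht), cone t (hsub ht)] with x hx hxc
    rw [← hx]
    by_cases hxR : t + R < ‖x‖
    · simp [hxc hxR]
    · rw [hη1 x (by linarith [ht.2]), mul_one]
  · intro s t ν hs hst htX hν hνu
    refine growth_of_ode hd (fun t _ => multiplier_pos μ β t)
      (fun t ht => multiplier_le_one hμ hβ ht.1)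
      (fun t ht => multiplier_mono hμ hβ le_rfl ht.1) hNi
      (fun s => integral_nonneg fun x =>
        mul_nonneg (Real.rpow_nonneg (abs_nonneg _) _) (hη0 x)) ?_ ?_ hs hst htX hν ?_
    · refine integral_nonneg_of_ae ?_
      filter_upwards [sol.initial_velocity, hg0] with x hx hgx
      rw [hx]
      exact mul_nonneg (mul_nonneg hε.le hgx) (hη0 x)
    · intro t ht
      rw [hode t ht]
      simp
    · filter_upwards [ae_restrict_of_ae_restrict_of_subset (Ioo_subset_Ioo hs htX) hNae,
        ae_restrict_mem measurableSet_Ioo] with r hr hrI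
      have hrX : r ∈ Icc 0 X := ⟨hs.trans hrI.1.le, hrI.2.le.trans htX⟩
      rw [← ENNReal.ofReal_le_ofReal_iff (integral_nonneg fun x =>
        mul_nonneg (Real.rpow_nonneg (abs_nonneg _) _) (hη0 x)),
        ofReal_integral_eq_lintegral_ofReal hr (.of_forall fun x =>
          mul_nonneg (Real.rpow_nonneg (abs_nonneg _) _) (hη0 x))]
      refine (hνu r hrI).trans (le_of_eq (lintegral_congr_ae ?_))
      filter_upwards [cone r (hsub hrX)] with x hxc
      by_cases hxR : r + R < ‖x‖
      · simp [hxc hxR, Real.zero_rpow (by linarith : p ≠ 0),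
          ENNReal.zero_rpow_of_pos (by linarith : 0 < p)]
      · rw [hη1 x (by linarith [hrX.2]), mul_one,
          ← ENNReal.ofReal_rpow_of_nonneg (abs_nonneg _) (by linarith), Real.enorm_eq_ofReal_abs]

/-! ### The lifespan bound -/

/-- The blow-up condition: if an energy solution supported in a cone is defined at time `2 τ`,
`τ ≥ 1`, then `ε ^ (p (p - 1)) τ ^ (γ(p, n) / 2)` is bounded. -/
theorem exists_lifespan_constant (k : ℕ) {p μ β R : ℝ} (hμ : 0 < μ) (hβ : 1 < β) (hp : 1 < p)
    (hR : 0 < R) {f g : E (k + 1) → ℝ} (hf0 : ∀ᵐ x, 0 ≤ f x) (hg0 : ∀ᵐ x, 0 ≤ g x)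
    (hfi : Integrable f) (hfpos : 0 < ∫ x, f x) :
    ∃ Q : ℝ, 0 < Q ∧ ∀ ε : ℝ, 0 < ε → ∀ (T : EReal) (u : ℝ → E (k + 1) → ℝ), 0 < T →
      IsEnergySolution p μ β ε f g T u → SupportedInCone R T u →
      ∀ τ : ℝ, 1 ≤ τ → ((2 * τ : ℝ) : EReal) < T →
        ε ^ (p * (p - 1)) * τ ^ (straussGamma p (k + 1) / 2) < Q := by
  obtain ⟨c₁, hc₁, h₁⟩ := exists_rpow_lower_bound k hp hR
  obtain ⟨c₂, hc₂, h₂⟩ := exists_rpow_lower_bound_of_integral (k + 1) hp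
  set m₀ := multiplier μ β 0 with hm₀
  have hm0 : 0 < m₀ := multiplier_pos μ β 0
  set c₀ : ℝ := m₀ / 2 * (Real.exp (-(2 * R)) * ∫ x, f x) with hc₀
  have hc0 : 0 < c₀ := by positivity
  set θ : ℝ := k * (1 - p / 2) with hθ
  -- The factor `2 ^ (-|θ|)` compares `r^θ` with `τ^θ` on `(τ/2, τ)` for either sign of `θ`; `1/8`
  -- comes from `(τ/2)² / 2`.
  set cA : ℝ := m₀ * (c₁ * c₀ ^ p * 2 ^ (-|θ|)) / 8 with hcA
  have hcA0 : 0 < cA := by positivity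
  set d : ℝ := ((k + 1 : ℕ) : ℝ) * (p - 1) with hd
  have hd0 : 0 < d := mul_pos (by positivity) (by linarith)
  -- `2 + R` bounds the slice radius: `r + R ≤ (2 + R) τ` for `r ≤ 2 τ` and `τ ≥ 1`.
  set cB : ℝ := m₀ * (c₂ * (2 + R) ^ (-d)) with hcB
  have hcB0 : 0 < cB := by positivity
  set D : ℝ := (2 / (1 - 2 ^ (-((p - 1) / 2)))) ^ 2 with hD
  have hD0 : 0 < D := by
    have : (2 : ℝ) ^ (-((p - 1) / 2)) < 1 :=
      Real.rpow_lt_one_of_one_lt_of_neg (by norm_num) (by linarith)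
    have : (0 : ℝ) < 1 - 2 ^ (-((p - 1) / 2)) := by linarith
    positivity
  refine ⟨D / (cB * cA ^ (p - 1)), by positivity, ?_⟩
  rintro ε hε T u hT ⟨U, G, V, sol⟩ cone τ hτ hτT
  have hτ0 : 0 < τ := by linarith
  have hX : 2 * τ ∈ timeInterval T := ⟨by linarith, hτT⟩
  have hsub := Icc_subset_timeInterval hX
  obtain ⟨F, hF0, hFu, hgrow⟩ := sol.exists_growth cone hT hε hμ hβ hR hp hf0 hg0 hX
  have hw : ∀ r ∈ Icc 0 (2 * τ), AEMeasurable fun x => ‖u r x‖ₑ := fun r hr =>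
    ((Lp.aestronglyMeasurable (U r)).congr (sol.ae_eq r (hsub hr)).symm).enorm
  have hwR : ∀ r ∈ Icc 0 (2 * τ), ∀ᵐ x, r + R < ‖x‖ → ‖u r x‖ₑ = 0 := by
    intro r hr
    filter_upwards [cone r (hsub hr)] with x hx hxR
    rw [hx hxR, enorm_zero]
  have hmono : ∀ s t, 0 ≤ s → s ≤ t → t ≤ 2 * τ → F s ≤ F t := by
    intro s t hs hst ht
    have := hgrow s t 0 hs hst ht le_rfl (by simp)
    simpa using this
  -- the first lower bound
  have hA : cA * ε ^ p * τ ^ (θ + 2) ≤ F τ := by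
    have hν : ∀ r ∈ Ioo (τ / 2) τ, ENNReal.ofReal (c₁ * (c₀ * ε) ^ p * (2 ^ (-|θ|) * τ ^ θ))
        ≤ ∫⁻ x, ‖u r x‖ₑ ^ p := by
      intro r hr
      have hr0 : 0 < r := by linarith [hr.1]
      have hrX : r ∈ Icc 0 (2 * τ) := ⟨hr0.le, by linarith [hr.2]⟩
      refine le_trans (ENNReal.ofReal_le_ofReal ?_)
        (h₁ r (by linarith [hr.1]) _ (hw r hrX) (hwR r hrX) (c₀ * ε) (by positivity) ?_)
      · gcongr
        have e1 : r = (r / τ) * τ := by field_simp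
        have h0 : 0 < r / τ := by positivity
        conv_rhs => rw [e1]
        rw [Real.mul_rpow h0.le hτ0.le]
        gcongr
        have h1 : r / τ ≤ 1 := by rw [div_le_one hτ0]; exact hr.2.le
        have h2 : 1 / 2 ≤ r / τ := by rw [le_div_iff₀ hτ0]; linarith [hr.1]
        calc (2 : ℝ) ^ (-|θ|) = (1 / 2) ^ |θ| := by
              rw [Real.rpow_neg (by norm_num), one_div, Real.inv_rpow (by norm_num)]
          _ ≤ (r / τ) ^ |θ| := Real.rpow_le_rpow (by norm_num) h2 (abs_nonneg _)
          _ ≤ (r / τ) ^ θ := Real.rpow_le_rpow_of_exponent_ge h0 h1 (le_abs_self θ)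
      · intro ξ _ hξ2
        have := sol.planeWave_lower_bound cone hT hε hμ hβ hR hf0 hg0 hfi hfpos (hsub hrX) hξ2
        rwa [show multiplier μ β 0 / 2 * (ε * (Real.exp (-(2 * R)) * ∫ x, f x)) = c₀ * ε by
          rw [hc₀]; ring] at this
    have h1 := hgrow (τ / 2) τ _ (by linarith) (by linarith) (by linarith) (by positivity) hν
    have h2 : 0 ≤ F (τ / 2) := hF0.trans (hmono 0 _ le_rfl (by linarith) (by linarith))
    have e2 : τ ^ (θ + 2) = τ ^ θ * τ ^ 2 := by
      rw [Real.rpow_add hτ0]; norm_num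
    have e3 : cA * ε ^ p * τ ^ (θ + 2)
        = m₀ * (c₁ * (c₀ * ε) ^ p * (2 ^ (-|θ|) * τ ^ θ)) * (τ - τ / 2) ^ 2 / 2 := by
      rw [e2, Real.mul_rpow hc0.le hε.le, hcA]; ring
    linarith
  -- the nonlinear growth
  have hB : ∀ s t M, τ ≤ s → s ≤ t → t ≤ τ + τ → 0 < M → M ≤ F s →
      M ≤ F t ∧ cB * τ ^ (-d) * M ^ p * (t - s) ^ 2 / 2 ≤ F t := by
    intro s t M hs hst ht hM hMs
    have ht' : t ≤ 2 * τ := by linarith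
    have hs0 : 0 ≤ s := hτ0.le.trans hs
    refine ⟨hMs.trans (hmono s t hs0 hst ht'), ?_⟩
    have hν : ∀ r ∈ Ioo s t, ENNReal.ofReal (c₂ * M ^ p * ((2 + R) * τ) ^ (-d))
        ≤ ∫⁻ x, ‖u r x‖ₑ ^ p := by
      intro r hr
      have hr0 : 0 < r := hs0.trans_lt hr.1
      have hrX : r ∈ Icc 0 (2 * τ) := ⟨hr0.le, by linarith [hr.2]⟩
      refine le_trans (ENNReal.ofReal_le_ofReal ?_)
        (h₂ (r + R) (by positivity) _ (hw r hrX) (hwR r hrX) M hM ?_)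
      · gcongr ?_ * ?_
        refine Real.rpow_le_rpow_of_nonpos (by positivity) ?_ (by linarith)
        nlinarith [hrX.2]
      · refine le_trans (ENNReal.ofReal_le_ofReal ?_) (hFu r hrX)
        exact hMs.trans (hmono s r hs0 hr.1.le hrX.2)
    have h1 := hgrow s t _ hs0 hst ht' (by positivity) hν
    have e3 : cB * τ ^ (-d) * M ^ p * (t - s) ^ 2 / 2
        = m₀ * (c₂ * M ^ p * ((2 + R) * τ) ^ (-d)) * (t - s) ^ 2 / 2 := by
      rw [Real.mul_rpow (by positivity) hτ0.le, hcB]; ring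
    linarith
  have hfin := doubling_bound hp (by positivity) (by positivity) hτ0.le hA hB
  rw [lt_div_iff₀ (by positivity)]
  refine lt_of_eq_of_lt ?_ hfin
  -- The Strauss polynomial emerges here: `-n (p - 1) + (p - 1) (θ + 2) + 2 = γ / 2`.
  have e4 : τ ^ (straussGamma p (k + 1) / 2) = τ ^ (-d) * (τ ^ (θ + 2)) ^ (p - 1) * τ ^ 2 := by
    rw [← Real.rpow_mul hτ0.le, ← Real.rpow_natCast τ 2, ← Real.rpow_add hτ0,
      ← Real.rpow_add hτ0]
    congr 1
    rw [straussGamma, hd, hθ]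
    push_cast
    ring
  rw [e4, Real.mul_rpow (by positivity) (by positivity),
    Real.mul_rpow hcA0.le (by positivity), ← Real.rpow_mul hε.le]
  ring

end DampedWave

end

theorem theorem1 (n : ℕ) (hn : 1 ≤ n) (β μ p R : ℝ) (hβ : 1 < β) (hμ : 0 < μ)
    (hp : 1 < p) (hpS : 2 ≤ n → p < DampedWave.straussExponent n) (hR : 1 ≤ R)
    (f g : DampedWave.E n → ℝ) (hf : DampedWave.MemH1 f) (hg : MemLp g 2)
    (hf0 : ∀ᵐ x, 0 ≤ f x) (hg0 : ∀ᵐ x, 0 ≤ g x) (hfne : ¬ f =ᵐ[volume] 0) :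
    ∃ ε₀ : ℝ, 0 < ε₀ ∧ ∃ C : ℝ, 0 < C ∧
      ∀ ε : ℝ, 0 < ε → ε ≤ ε₀ →
        ∀ (T : EReal) (u : ℝ → DampedWave.E n → ℝ), 0 < T →
          DampedWave.IsEnergySolution p μ β ε f g T u →
          DampedWave.SupportedInCone R T u →
          T ≤ ((C * ε ^ (-(2 * p * (p - 1) / DampedWave.straussGamma p n)) : ℝ) : EReal) := by
  have hγ := DampedWave.straussGamma_pos hn hp hpS
  have hR0 : 0 < R := by linarith
  -- data that are not supported in the ball of radius `R` admit no solution in the cone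
  by_cases hfR : ∀ᵐ x, R < ‖x‖ → f x = 0
  swap
  · refine ⟨1, one_pos, 1, one_pos, fun ε hε _ T u hT ⟨U, G, V, sol⟩ cone => ?_⟩
    exact absurd (sol.data_ae_eq_zero cone hT hε) hfR
  have hfi : Integrable f := by
    have : IsFiniteMeasure (volume.restrict (Metric.closedBall (0 : DampedWave.E n) R)) :=
      isFiniteMeasure_restrict.mpr Metric.isBounded_closedBall.measure_lt_top.ne
    have h1 : IntegrableOn f (Metric.closedBall 0 R) :=
      (hf.1.restrict _).integrable (by norm_num)
    refine h1.integrable_of_ae_notMem_eq_zero ?_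
    filter_upwards [hfR] with x hx hxS
    exact hx (by simpa using hxS)
  have hfpos : 0 < ∫ x, f x := by
    refine lt_of_le_of_ne (integral_nonneg_of_ae hf0) fun h => hfne ?_
    exact (integral_eq_zero_iff_of_nonneg_ae hf0 hfi).mp h.symm
  obtain ⟨k, rfl⟩ : ∃ k, n = k + 1 := ⟨n - 1, by omega⟩
  obtain ⟨Q, hQ, hlife⟩ :=
    DampedWave.exists_lifespan_constant k hμ hβ hp hR0 hf0 hg0 hfi hfpos
  set γ := DampedWave.straussGamma p (k + 1) with hγdef
  -- `Q ^ (2 / γ)` ensures `K^(γ/2) ≥ Q`; the maximum with `1`, together with `ε ≤ 1`, makes `τ = K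
  -- ε^(-α)` at least `1`. If `T > 2 τ`, then `ε^(p (p - 1)) τ^(γ/2) = K^(γ/2) ≥ Q`, a contradiction
  -- that also covers `T = ⊤`.
  set K : ℝ := max 1 (Q ^ (2 / γ)) with hK
  have hK1 : 1 ≤ K := le_max_left _ _
  refine ⟨1, one_pos, 2 * K, by linarith, fun ε hε hε1 T u hT sol cone => ?_⟩
  by_contra! hcon
  set α : ℝ := 2 * p * (p - 1) / γ with hα
  have hα0 : 0 < α := div_pos (mul_pos (by linarith) (by linarith)) hγ
  have hεα : 1 ≤ ε ^ (-α) := Real.one_le_rpow_of_pos_of_le_one_of_nonpos hε hε1 (by linarith)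
  have h1 := hlife ε hε T u hT sol cone (K * ε ^ (-α)) (one_le_mul_of_one_le_of_one_le hK1 hεα)
    (by rwa [← mul_assoc])
  have hK0 : 0 ≤ K := by linarith
  rw [Real.mul_rpow hK0 (by positivity), ← Real.rpow_mul hε.le,
    show -α * (γ / 2) = -(p * (p - 1)) by rw [hα]; field_simp, Real.rpow_neg hε.le] at h1
  have h2 : Q ≤ K ^ (γ / 2) := by
    calc Q = (Q ^ (2 / γ)) ^ (γ / 2) := by
          rw [← Real.rpow_mul hQ.le, div_mul_div_cancel₀ hγ.ne', div_self two_ne_zero,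
            Real.rpow_one]
      _ ≤ K ^ (γ / 2) :=
          Real.rpow_le_rpow (by positivity) (le_max_right _ _) (by positivity)
  have h3 : ε ^ (p * (p - 1)) * (K ^ (γ / 2) * (ε ^ (p * (p - 1)))⁻¹) = K ^ (γ / 2) := by
    field_simp
  linarith
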